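/- **Setting.** Let $\alpha=(\alpha_1,\dots,\alpha_n)\neq 0$ be nonnegative integers, $I_\alpha=\{i : \alpha_i>0\}$, and let $k\ge 1$ be an integer. Let $\tilde U$ be an open set of values of the coordinates $(x_j)_{j\notin I_\alpha}$ and $U=\{x\in\mathbb R^n : (x_j)_{j\notin I_\alpha}\in\tilde U\}$. Let $f:U\to\mathbb R^n$ be a smooth vector field that is asymptotically quasi-homogeneous of type $\alpha$ and order $k+1$ at infinity: there is a smooth $f_{\alpha,k}:U\to\mathbb R^n$ with $(f_{\alpha,k})_j(R^{\alpha_1}x_1,\dots,R^{\alpha_n}x_n)=R^{k+\alpha_j}(f_{\alpha,k})_j(x)$ for all $x\in U$, $R\in\mathbb R$ and all $j$, such that, for each $j$, $$\lim_{R\to+\infty}R^{-(k+\alpha_j)}\bigl\{f_j(R^{\alpha_1}x_1,\dots,R^{\alpha_n}x_n)-R^{k+\alpha_j}(f_{\alpha,k})_j(x)\bigr\}=0$$ uniformly on $\{x\in U:\sum_{i\in I_\alpha}x_i^2=1\}$. Let $a_1,\dots,a_n\ge 1$ be reals, $c\ge1$ an integer, and $\beta_1,\dots,\beta_n$ nonnegative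 integers with $\alpha_i\beta_i=c$ for $i\in I_\alpha$ and $\beta_i=0$ otherwise. Put $$p(y)=\Bigl(\sum_{i\in I_\alpha}a_iy_i^{2\beta_i}\Bigr)^{1/2c},\qquad \kappa(y)=(1+p(y)^{2c})^{1/2c},\qquad T_{qP}(y)_i=y_i/\kappa(y)^{\alpha_i},$$ $\mathcal D=\{x=T_{qP}(y) : y\in U,\ p(x)<1\}$, $\mathcal E=\{x\in U : p(x)=1\}$ (the horizon) and $\overline{\mathcal D}=\mathcal D\cup\mathcal E$. For $x\in\mathcal D$ let $\kappa=(1-\sum_{j\in I_\alpha}a_jx_j^{2\beta_j})^{-1/2c}$ and $\tilde f_j(x)=\kappa^{-(k+\alpha_j)}f_j(\kappa^{\alpha_1}x_1,\dots,\kappa^{\alpha_n}x_n)$; for $x\in\mathcal E$ let $\tilde f(x)=f_{\alpha,k}(x)$. The desingularized vector field $g$ on $\overline{\mathcal D}$ is $$g_i=\tilde f_i-\Bigl(\sum_{j\in I_\alpha}\beta_ja_jx_j^{2\beta_j-1}\tilde f_j\Bigr)\frac{x_i}{\beta_i}\quad(i\in I_\alpha),\qquad g_i=\tilde f_i\quad(i\notin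 I_\alpha).$$ **Theorem (Stationary blow-up).** Let $x_*\in\mathcal E$ be an equilibrium at infinity, i.e. $g(x_*)=0$. Suppose that $g$ is $C^1$ on a set $V\supset\mathcal E$ that is open in $\overline{\mathcal D}$, and that $x_*$ is hyperbolic: no eigenvalue of the Jacobian matrix $Jg(x_*)$ has real part zero, and the number $n_s$ of those with negative real part is positive. Let $W^s(x_*)$ be the set of initial points $x(0)$ of solutions $x(\tau)\in\overline{\mathcal D}$, $\tau\ge0$, of $dx/d\tau=g(x)$ with $x(\tau)\to x_*$ as $\tau\to\infty$. Let $y(t)$, $t_0\le t<t_{\max}\le\infty$, be a solution of $y'=f(y)$ in $U$ with maximal existence time $t_{\max}$, whose image under $T_{qP}$ lies on $W^s(x_*)$ (it suffices that $T_{qP}(y(t_0))\in W^s(x_*)$). Then $t_{\max}<\infty$, and there is a constant $C>0$ with $$\frac{p(y(t))}{C\,(t_{\max}-t)^{-1/k}}\to 1\qquad\text{as } t\to t_{\max}-0 .$$ Moreover, for every $i\in I_\alpha$ with $(x_*)_i\ne0$ there is a constant $C_i\neq0$ with $$\frac{y_i(t)}{C_i\,(t_{\max}-t)^{-\alpha_i/k}}\to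 1\qquad\text{as } t\to t_{\max}-0 .$$ -/

import Mathlib

open Set Filter Topology Asymptotics
open scoped ContDiff

noncomputable section

namespace QuasiPoincare

variable {n : ℕ}

/-- The set `I_α` of homogeneity indices. -/
def homIndices (α : Fin n → ℕ) : Finset (Fin n) :=
  Finset.univ.filter fun i => 0 < α i

/-- The quasi-homogeneous scaling `x ↦ (R^{α_1} x_1, …, R^{α_n} x_n)`. -/
def scale (α : Fin n → ℕ) (R : ℝ) (x : Fin n → ℝ) : Fin n → ℝ :=
  fun i => R ^ α i * x i

/-- The admissible domain over a set `W` (open, in all uses) of values of the coordinates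
outside `I_α`; the coordinates in `I_α` are unrestricted. -/
def admissibleDomain (α : Fin n → ℕ) (W : Set ({i : Fin n // α i = 0} → ℝ)) :
    Set (Fin n → ℝ) :=
  {x | (fun j : {i : Fin n // α i = 0} => x j) ∈ W}

/-- The part of the admissible domain whose `I_α`-coordinates lie on the Euclidean unit sphere. -/
def sphereDomain (α : Fin n → ℕ) (W : Set ({i : Fin n // α i = 0} → ℝ)) :
    Set (Fin n → ℝ) :=
  {x | x ∈ admissibleDomain α W ∧ ∑ i ∈ homIndices α, x i ^ 2 = 1}

/-- `F` is a smooth quasi-homogeneous vector field of type `α` and order `k + 1` on `U`. -/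
structure IsQuasiHomogeneous (α : Fin n → ℕ) (k : ℕ) (U : Set (Fin n → ℝ))
    (F : (Fin n → ℝ) → (Fin n → ℝ)) : Prop where
  smooth : ContDiffOn ℝ ∞ F U
  homogeneous : ∀ x ∈ U, ∀ (R : ℝ) (j : Fin n), F (scale α R x) j = R ^ (k + α j) * F x j

/-- `f` is a smooth vector field on the admissible domain over `W`, asymptotically
quasi-homogeneous of type `α` and order `k + 1` at infinity, with quasi-homogeneous
part `fα`. -/
structure IsAsymptoticallyQuasiHomogeneous (α : Fin n → ℕ) (k : ℕ)
    (W : Set ({i : Fin n // α i = 0} → ℝ)) (f fα : (Fin n → ℝ) → (Fin n → ℝ)) : Prop where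
  smooth : ContDiffOn ℝ ∞ f (admissibleDomain α W)
  quasiHomogeneous : IsQuasiHomogeneous α k (admissibleDomain α W) fα
  tendsto : ∀ j : Fin n, TendstoUniformlyOn
    (fun (R : ℝ) x => (R ^ (k + α j))⁻¹ * (f (scale α R x) j - R ^ (k + α j) * fα x j))
    (fun _ => 0) atTop (sphereDomain α W)

/-- Admissible parameters of a quasi-Poincaré compactification of type `α`. -/
structure IsCompactificationData (α β : Fin n → ℕ) (c : ℕ) (a : Fin n → ℝ) : Prop where
  type_ne_zero : α ≠ 0
  c_pos : 0 < c
  one_le_a : ∀ i, 1 ≤ a i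
  mul_eq : ∀ i ∈ homIndices α, α i * β i = c
  eq_zero : ∀ i ∉ homIndices α, β i = 0

variable (α β : Fin n → ℕ) (c : ℕ) (a : Fin n → ℝ)

/-- The functional `p`. -/
def p (y : Fin n → ℝ) : ℝ :=
  (∑ i ∈ homIndices α, a i * y i ^ (2 * β i)) ^ (1 / (2 * c : ℝ))

/-- The functional `κ`. -/
def kappa (y : Fin n → ℝ) : ℝ :=
  (1 + p α β c a y ^ (2 * c)) ^ (1 / (2 * c : ℝ))

/-- The quasi-Poincaré compactification `T_{qP}`. -/
def compactification (y : Fin n → ℝ) : Fin n → ℝ :=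
  fun i => y i / kappa α β c a y ^ α i

/-- The horizon `ℰ = {x ∈ U | p(x) = 1}`. -/
def horizon (W : Set ({i : Fin n // α i = 0} → ℝ)) : Set (Fin n → ℝ) :=
  {x | x ∈ admissibleDomain α W ∧ p α β c a x = 1}

/-- The set `𝒟 = {x | x = T_{qP}(y), y ∈ U, p(x) < 1}`. -/
def disc (W : Set ({i : Fin n // α i = 0} → ℝ)) : Set (Fin n → ℝ) :=
  {x | x ∈ compactification α β c a '' admissibleDomain α W ∧ p α β c a x < 1}

/-- The compactified phase space: `𝒟` together with the horizon
(the closure of `𝒟` relative to `U`). -/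
def closedDisc (W : Set ({i : Fin n // α i = 0} → ℝ)) : Set (Fin n → ℝ) :=
  disc α β c a W ∪ horizon α β c a W

/-- The functional `κ` in the `x`-coordinate, `κ(T_{qP}⁻¹(x))`, for `p(x) < 1`. -/
def kappaX (x : Fin n → ℝ) : ℝ :=
  (1 - ∑ j ∈ homIndices α, a j * x j ^ (2 * β j)) ^ (-(1 / (2 * c : ℝ)))

/-- The rescaled field `f̃_j(x) = κ^{-(k+α_j)} f_j(κ^{α_1} x_1, …, κ^{α_n} x_n)`, extended to the
horizon by its limit, the quasi-homogeneous part `fα`. -/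
def fTilde (k : ℕ) (f fα : (Fin n → ℝ) → (Fin n → ℝ)) (x : Fin n → ℝ) : Fin n → ℝ :=
  fun j =>
    if p α β c a x < 1 then
      (kappaX α β c a x ^ (k + α j))⁻¹ * f (scale α (kappaX α β c a x) x) j
    else fα x j

/-- The desingularized vector field `g`. -/
def desingularized (k : ℕ) (f fα : (Fin n → ℝ) → (Fin n → ℝ)) (x : Fin n → ℝ) : Fin n → ℝ :=
  fun i =>
    if i ∈ homIndices α then
      fTilde α β c a k f fα x i -
        (∑ j ∈ homIndices α, β j * a j * x j ^ (2 * β j - 1) * fTilde α β c a k f fα x j) *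
          (x i / β i)
    else fTilde α β c a k f fα x i

/-- `x` is an equilibrium at infinity: a zero of `g` on the horizon. -/
def IsEquilibriumAtInfinity (W : Set ({i : Fin n // α i = 0} → ℝ)) (k : ℕ)
    (f fα : (Fin n → ℝ) → (Fin n → ℝ)) (x : Fin n → ℝ) : Prop :=
  x ∈ horizon α β c a W ∧ desingularized α β c a k f fα x = 0

/-- The Jacobian matrix of `g` at `x`, the derivative being taken within the set `s`. -/
def jacobianWithin (g : (Fin n → ℝ) → (Fin n → ℝ)) (s : Set (Fin n → ℝ)) (x : Fin n → ℝ) :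
    Matrix (Fin n) (Fin n) ℝ :=
  LinearMap.toMatrix' (fderivWithin ℝ g s x : (Fin n → ℝ) →ₗ[ℝ] (Fin n → ℝ))

/-- The complex eigenvalues of a real matrix, with algebraic multiplicity. -/
def eigenvaluesC (J : Matrix (Fin n) (Fin n) ℝ) : Multiset ℂ :=
  (J.map (algebraMap ℝ ℂ)).charpoly.roots

/-- No eigenvalue lies on the imaginary axis. -/
def IsHyperbolicMatrix (J : Matrix (Fin n) (Fin n) ℝ) : Prop :=
  ∀ μ ∈ eigenvaluesC J, μ.re ≠ 0

/-- The number `n_s` of eigenvalues with negative real part. -/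
def stableCount (J : Matrix (Fin n) (Fin n) ℝ) : ℕ :=
  ((eigenvaluesC J).filter fun μ => μ.re < 0).card

/-- The stable set `W^s(x_*)` of `x_*` for `g` in the phase space `s`: all initial points of
solutions of `dx/dτ = g(x)` in `s` that exist for all `τ ≥ 0` and converge to `x_*`. -/
def stableSet (g : (Fin n → ℝ) → (Fin n → ℝ)) (s : Set (Fin n → ℝ)) (xs : Fin n → ℝ) :
    Set (Fin n → ℝ) :=
  {x₀ | ∃ x : ℝ → (Fin n → ℝ), x 0 = x₀ ∧
    (∀ τ, 0 ≤ τ → x τ ∈ s ∧ HasDerivWithinAt x (g (x τ)) (Ici 0) τ) ∧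
    Tendsto x atTop (𝓝 xs)}

/-- `y` solves `y' = f(y)` in `U` on `[t₀, T)`. -/
def IsSolutionOn (f : (Fin n → ℝ) → (Fin n → ℝ)) (U : Set (Fin n → ℝ))
    (y : ℝ → (Fin n → ℝ)) (t₀ : ℝ) (T : EReal) : Prop :=
  ∀ t : ℝ, t₀ ≤ t → (t : EReal) < T →
    y t ∈ U ∧ HasDerivWithinAt y (f (y t)) (Ici t₀) t

/-- `y` solves `y' = f(y)` in `U` on `[t₀, T)`, and `T` is its maximal existence time: no
solution on a longer interval `[t₀, T')` extends `y`. -/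
structure IsMaximalSolution (f : (Fin n → ℝ) → (Fin n → ℝ)) (U : Set (Fin n → ℝ))
    (y : ℝ → (Fin n → ℝ)) (t₀ : ℝ) (T : EReal) : Prop where
  lt : (t₀ : EReal) < T
  solution : IsSolutionOn f U y t₀ T
  maximal : ∀ (T' : EReal) (z : ℝ → (Fin n → ℝ)), IsSolutionOn f U z t₀ T' →
    (∀ t : ℝ, t₀ ≤ t → (t : EReal) < T → z t = y t) → T' ≤ T

end QuasiPoincare

end

/-!
Let `q = ∑ aⱼ xⱼ ^ (2βⱼ) = p ^ (2c)` and let `G` be the radial rate `∑ βⱼ aⱼ xⱼ ^ (2βⱼ - 1) f̃ⱼ`.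
Along the desingularized field, `w = 1 - q` satisfies the linear equation `w' = -2 G w`, so at a
point of the horizon the differential of `q` is a left eigenvector of the Jacobian with eigenvalue
`-2 G(x⋆)`. Hyperbolicity therefore forces `G(x⋆) ≠ 0`, and convergence to `x⋆` from inside the disc
forces `G(x⋆) > 0`.

In the original time, `(κ ^ (-k))' = -(k / c) G(T y)`, and the right-hand side tends to a
negative constant. Hence `κ ^ (-k)` reaches zero after a finite time, linearly, which gives the rate
of `κ`; the rates of `p(y) = κ p(x)` and `yᵢ = κ ^ αᵢ xᵢ` follow because `x → x⋆` and `p(x⋆) = 1`.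
-/

namespace QuasiPoincare

section Calculus

theorem nonpos_of_tendsto_zero_of_hasDerivWithinAt_mul {w b : ℝ → ℝ} {B : ℝ}
    (hpos : ∀ τ, 0 ≤ τ → 0 < w τ)
    (hderiv : ∀ τ, 0 ≤ τ → HasDerivWithinAt w (b τ * w τ) (Ici 0) τ)
    (hw : Tendsto w atTop (𝓝 0)) (hb : Tendsto b atTop (𝓝 B)) : B ≤ 0 := by
  by_contra! hB
  obtain ⟨τ₀, hτ₀⟩ := eventually_atTop.1
    ((hb.eventually (lt_mem_nhds hB)).and (eventually_ge_atTop 0))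
  have h₀ : 0 ≤ τ₀ := (hτ₀ τ₀ le_rfl).2
  have hderiv' : ∀ τ ∈ Ici τ₀, HasDerivWithinAt w (b τ * w τ) (Ici τ₀) τ := fun τ hτ =>
    (hderiv τ (h₀.trans hτ)).mono (Ici_subset_Ici.2 h₀)
  have hmono : MonotoneOn w (Ici τ₀) :=
    monotoneOn_of_hasDerivWithinAt_nonneg (convex_Ici τ₀)
      (fun τ hτ => (hderiv' τ hτ).continuousWithinAt)
      (fun τ hτ => (hderiv' τ (interior_subset hτ)).mono interior_subset)
      fun τ hτ => mul_nonneg (hτ₀ τ (interior_subset hτ)).1.le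
        (hpos τ (h₀.trans (interior_subset hτ))).le
  exact (hpos τ₀ h₀).not_ge <| ge_of_tendsto hw <|
    (eventually_ge_atTop τ₀).mono fun τ hτ => hmono self_mem_Ici hτ hτ

theorem nonneg_of_tendsto_deriv_of_pos {u u' : ℝ → ℝ} {t₀ A : ℝ}
    (hpos : ∀ t, t₀ ≤ t → 0 < u t)
    (hderiv : ∀ t, t₀ ≤ t → HasDerivWithinAt u (u' t) (Ici t₀) t)
    (hu' : Tendsto u' atTop (𝓝 A)) : 0 ≤ A := by
  by_contra! hA
  obtain ⟨t₁, ht₁⟩ := eventually_atTop.1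
    ((hu'.eventually (gt_mem_nhds (show A < A / 2 by linarith))).and (eventually_ge_atTop t₀))
  have h₀₁ : t₀ ≤ t₁ := (ht₁ t₁ le_rfl).2
  have hderiv' : ∀ t ∈ Ici t₁, HasDerivWithinAt (fun t => u t - A / 2 * t) (u' t - A / 2)
      (Ici t₁) t := fun t ht => by
    simpa using ((hderiv t (h₀₁.trans ht)).mono (Ici_subset_Ici.2 h₀₁)).fun_sub
      ((hasDerivAt_id t).const_mul (A / 2)).hasDerivWithinAt
  have hanti : AntitoneOn (fun t => u t - A / 2 * t) (Ici t₁) :=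
    antitoneOn_of_hasDerivWithinAt_nonpos (convex_Ici t₁)
      (fun t ht => (hderiv' t ht).continuousWithinAt)
      (fun t ht => (hderiv' t (interior_subset ht)).mono interior_subset)
      fun t ht => by linarith [(ht₁ t (interior_subset ht)).1]
  -- the line through `(t₁, u t₁)` of slope `A / 2` bounds `u` from above and vanishes at `t₂`
  set t₂ := t₁ + u t₁ / -(A / 2) with ht₂
  have h₁₂ : t₁ ≤ t₂ := le_add_of_nonneg_right <|
    div_nonneg (hpos t₁ h₀₁).le (by linarith)
  have hle : u t₂ - A / 2 * t₂ ≤ u t₁ - A / 2 * t₁ := hanti self_mem_Ici h₁₂ h₁₂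
  have hzero : u t₁ + A / 2 * (t₂ - t₁) = 0 := by
    rw [ht₂]; field_simp [hA.ne]; ring
  linarith [hpos t₂ (h₀₁.trans h₁₂)]

theorem tendsto_nhdsLT_atTop_or_nhds_of_monotoneOn {φ : ℝ → ℝ} {t₀ T : ℝ} (hT : t₀ < T)
    (hφ : MonotoneOn φ (Ioo t₀ T)) :
    Tendsto φ (𝓝[<] T) atTop ∨ ∃ S, Tendsto φ (𝓝[<] T) (𝓝 S) := by
  by_cases hbdd : BddAbove (φ '' Ioo t₀ T)
  · exact Or.inr ⟨_, hφ.tendsto_nhdsWithin_Ioo_left (nonempty_Ioo.2 hT) hbdd⟩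
  · refine Or.inl (tendsto_atTop.2 fun B => ?_)
    obtain ⟨_, ⟨r, hr, rfl⟩, hB⟩ := not_bddAbove_iff.1 hbdd B
    filter_upwards [Ioo_mem_nhdsLT hr.2] with t ht
    exact hB.le.trans (hφ hr ⟨hr.1.trans ht.1, ht.2⟩ ht.1.le)

theorem isEquivalent_const_mul_sub_of_tendsto_deriv {u u' : ℝ → ℝ} {T A : ℝ} (hA : A ≠ 0)
    (hderiv : ∀ᶠ t in 𝓝[<] T, HasDerivAt u (u' t) t) (hu : Tendsto u (𝓝[<] T) (𝓝 0))
    (hu' : Tendsto u' (𝓝[<] T) (𝓝 (-A))) : u ~[𝓝[<] T] fun t => A * (T - t) := by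
  have hlin : Tendsto (fun t => A * (T - t)) (𝓝[<] T) (𝓝 0) := by
    have : Continuous fun t => A * (T - t) := by fun_prop
    simpa using (this.tendsto T).mono_left nhdsWithin_le_nhds
  have hratio : Tendsto (fun t => u t / (A * (T - t))) (𝓝[<] T) (𝓝 1) := by
    refine HasDerivAt.lhopital_zero_nhdsLT (g' := fun _ => -A) hderiv
      (Eventually.of_forall fun t => ?_) (Eventually.of_forall fun _ => neg_ne_zero.2 hA)
      hu hlin ?_
    · simpa using ((hasDerivAt_id t).const_sub T).const_mul A
    · simpa [hA] using hu'.div_const (-A)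
  exact isEquivalent_of_tendsto_one hratio

theorem hasFDerivWithinAt_smul_of_eq_zero {𝕜 E F : Type*} [NontriviallyNormedField 𝕜]
    [NormedAddCommGroup E] [NormedSpace 𝕜 E] [NormedAddCommGroup F] [NormedSpace 𝕜 F]
    {φ : E → 𝕜} {ψ : E → F} {ψ' : E →L[𝕜] F} {s : Set E} {x : E}
    (hφ : ContinuousWithinAt φ s x) (hψ : HasFDerivWithinAt ψ ψ' s x) (h0 : ψ x = 0) :
    HasFDerivWithinAt (fun z => φ z • ψ z) (φ x • ψ') s x := by
  refine .of_isLittleO ?_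
  have hψo : (fun z => ψ z - ψ' (z - x)) =o[𝓝[s] x] fun z => z - x := by
    simpa [h0] using hψ.isLittleO
  have hφo : (fun z => φ z - φ x) =o[𝓝[s] x] fun _ => (1 : 𝕜) :=
    (isLittleO_one_iff 𝕜).2 (by simpa using hφ.tendsto.sub_const (φ x))
  have hmain : (fun z => φ z • (ψ z - ψ' (z - x))) =o[𝓝[s] x] fun z => z - x := by
    simpa using (hφ.tendsto.isBigO_one 𝕜).smul_isLittleO hψo
  have herror : (fun z => (φ z - φ x) • ψ' (z - x)) =o[𝓝[s] x] fun z => z - x := by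
    simpa using hφo.smul_isBigO (ψ'.isBigO_sub (𝓝[s] x) x)
  refine (hmain.add herror).congr_left fun z => ?_
  simp only [h0, smul_zero, sub_zero, smul_apply, smul_sub, sub_smul]
  abel

end Calculus

section LinearAlgebra

theorem ofReal_mem_eigenvaluesC_of_vecMul_eq_smul {n : ℕ} {J : Matrix (Fin n) (Fin n) ℝ}
    {v : Fin n → ℝ} {μ : ℝ} (hv : v ≠ 0) (h : Matrix.vecMul v J = μ • v) :
    (μ : ℂ) ∈ eigenvaluesC J := by
  have hdet : (Matrix.scalar (Fin n) μ - J).det = 0 :=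
    Matrix.exists_vecMul_eq_zero_iff.1 ⟨v, hv, by
      rw [Matrix.vecMul_sub, h, Matrix.scalar_apply, Matrix.vecMul_diagonal_const]; simp⟩
  have hroot : (J.map (algebraMap ℝ ℂ)).charpoly.eval (μ : ℂ) = 0 := by
    rw [← Matrix.eval_charpoly] at hdet
    rw [Matrix.charpoly_map, ← Complex.coe_algebraMap, Polynomial.eval_map_apply, hdet, map_zero]
  exact (Polynomial.mem_roots (Matrix.charpoly_monic _).ne_zero).2 hroot

theorem ofReal_mem_eigenvaluesC_of_comp_eq_smul {n : ℕ} {L : (Fin n → ℝ) →ₗ[ℝ] (Fin n → ℝ)}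
    {ℓ : (Fin n → ℝ) →ₗ[ℝ] ℝ} {μ : ℝ} (hℓ : ℓ ≠ 0) (h : ℓ ∘ₗ L = μ • ℓ) :
    (μ : ℂ) ∈ eigenvaluesC (LinearMap.toMatrix' L) := by
  have hℓ_apply : ∀ v, ℓ v = (fun i => ℓ (Pi.single i 1)) ⬝ᵥ v := fun v => by
    conv_lhs => rw [pi_eq_sum_univ' v]
    simp [dotProduct, mul_comm]
  refine ofReal_mem_eigenvaluesC_of_vecMul_eq_smul (v := fun i => ℓ (Pi.single i 1))
    (fun hv => hℓ (LinearMap.ext fun v => by rw [hℓ_apply, hv, zero_dotProduct]; rfl)) ?_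
  ext j
  have hcol : (fun i => LinearMap.toMatrix' L i j) = L (Pi.single j 1) := by
    ext i
    rw [LinearMap.toMatrix'_apply]
  rw [Matrix.vecMul, hcol, ← hℓ_apply]
  exact LinearMap.congr_fun h (Pi.single j 1)

end LinearAlgebra

section ODE

variable {E : Type*} [NormedAddCommGroup E] [NormedSpace ℝ E]

theorem ne_zero_of_hasDerivWithinAt_smul {w : ℝ → E} {b : ℝ → ℝ} {t₀ t₁ : ℝ} (h₀₁ : t₀ ≤ t₁)
    (hb : ContinuousOn b (Icc t₀ t₁))
    (hw : ∀ t ∈ Icc t₀ t₁, HasDerivWithinAt w (b t • w t) (Icc t₀ t₁) t) (h₀ : w t₀ ≠ 0) :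
    w t₁ ≠ 0 := fun h₁ => by
  obtain ⟨M, hM⟩ := isCompact_Icc.exists_bound_of_continuousOn hb
  have hlip : ∀ t ∈ Ioc t₀ t₁, LipschitzOnWith M.toNNReal (fun z : E => b t • z) univ :=
    fun t ht => ((lipschitzWith_smul (b t)).weaken
      (NNReal.le_toNNReal_of_coe_le (hM t (Ioc_subset_Icc_self ht)))).lipschitzOnWith
  refine h₀ <| ODE_solution_unique_of_mem_Icc_left (f := w) (g := fun _ => 0) (s := fun _ => univ)
    hlip (fun t ht => (hw t ht).continuousWithinAt) (fun t ht => ?_) (fun _ _ => mem_univ _)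
    continuousOn_const (fun t _ => ?_) (fun _ _ => mem_univ _) h₁ (left_mem_Icc.2 h₀₁)
  · exact (hw t (Ioc_subset_Icc_self ht)).mono_of_mem_nhdsWithin (Icc_mem_nhdsLE_of_mem ht)
  · simpa using hasDerivWithinAt_const t (Iic t) (0 : E)

theorem eqOn_Icc_of_hasDerivWithinAt_smul {g : E → E} {D : Set E} (hD : IsOpen D)
    (hg : ContDiffOn ℝ 1 g D) {lam : ℝ → ℝ} {t₀ t₁ : ℝ} (hlam : ContinuousOn lam (Icc t₀ t₁))
    {u v : ℝ → E}
    (hu : ∀ t ∈ Icc t₀ t₁, u t ∈ D ∧ HasDerivWithinAt u (lam t • g (u t)) (Icc t₀ t₁) t)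
    (hv : ∀ t ∈ Icc t₀ t₁, v t ∈ D ∧ HasDerivWithinAt v (lam t • g (v t)) (Icc t₀ t₁) t)
    (h₀ : u t₀ = v t₀) : EqOn u v (Icc t₀ t₁) := by
  have hu_cont : ContinuousOn u (Icc t₀ t₁) := fun t ht => (hu t ht).2.continuousWithinAt
  have hv_cont : ContinuousOn v (Icc t₀ t₁) := fun t ht => (hv t ht).2.continuousWithinAt
  set S := u '' Icc t₀ t₁ ∪ v '' Icc t₀ t₁
  have hS : IsCompact S := (isCompact_Icc.image_of_continuousOn hu_cont).union
    (isCompact_Icc.image_of_continuousOn hv_cont)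
  have hSD : S ⊆ D := union_subset (image_subset_iff.2 fun t ht => (hu t ht).1)
    (image_subset_iff.2 fun t ht => (hv t ht).1)
  have hlocLip : LocallyLipschitzOn S g := fun x hx => by
    obtain ⟨K, N, hN, hK⟩ := (hg.contDiffAt (hD.mem_nhds (hSD hx))).exists_lipschitzOnWith
    exact ⟨K, N, mem_nhdsWithin_of_mem_nhds hN, hK⟩
  obtain ⟨K, hK⟩ := hlocLip.exists_lipschitzOnWith_of_compact hS
  obtain ⟨M, hM⟩ := isCompact_Icc.exists_bound_of_continuousOn hlam
  have hlip : ∀ t ∈ Ico t₀ t₁, LipschitzOnWith (M.toNNReal * K) (fun z => lam t • g z) S :=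
    fun t ht => ((lipschitzWith_smul (lam t)).weaken (NNReal.le_toNNReal_of_coe_le
      (hM t (Ico_subset_Icc_self ht)))).comp_lipschitzOnWith hK
  have hIci : ∀ t ∈ Ico t₀ t₁, Icc t₀ t₁ ∈ 𝓝[≥] t := fun t ht => Icc_mem_nhdsGE_of_mem ht
  exact ODE_solution_unique_of_mem_Icc_right (s := fun _ => S) hlip
    hu_cont (fun t ht => (hu t (Ico_subset_Icc_self ht)).2.mono_of_mem_nhdsWithin (hIci t ht))
    (fun t ht => Or.inl (mem_image_of_mem u (Ico_subset_Icc_self ht)))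
    hv_cont (fun t ht => (hv t (Ico_subset_Icc_self ht)).2.mono_of_mem_nhdsWithin (hIci t ht))
    (fun t ht => Or.inr (mem_image_of_mem v (Ico_subset_Icc_self ht))) h₀

theorem eq_comp_integral_of_hasDerivWithinAt_smul {g : E → E} {D : Set E} (hD : IsOpen D)
    (hg : ContDiffOn ℝ 1 g D) {lam : ℝ → ℝ} {t₀ t₁ : ℝ} (h₀₁ : t₀ ≤ t₁)
    (hlam : ContinuousOn lam (Icc t₀ t₁)) (hlam_nonneg : ∀ t ∈ Icc t₀ t₁, 0 ≤ lam t) {u x : ℝ → E}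
    (hu : ∀ t ∈ Icc t₀ t₁, u t ∈ D ∧ HasDerivWithinAt u (lam t • g (u t)) (Icc t₀ t₁) t)
    (hx : ∀ τ, 0 ≤ τ → x τ ∈ D ∧ HasDerivWithinAt x (g (x τ)) (Ici 0) τ) (h₀ : u t₀ = x 0) :
    u t₁ = x (∫ t in t₀..t₁, lam t) := by
  have hnonneg : ∀ t ∈ Icc t₀ t₁, 0 ≤ ∫ r in t₀..t, lam r := fun t ht =>
    intervalIntegral.integral_nonneg ht.1 fun r hr => hlam_nonneg r ⟨hr.1, hr.2.trans ht.2⟩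
  have hderiv : ∀ t ∈ Icc t₀ t₁,
      HasDerivWithinAt (fun r => ∫ s in t₀..r, lam s) (lam t) (Icc t₀ t₁) t := fun t ht => by
    have : Fact (t ∈ Icc t₀ t₁) := ⟨ht⟩
    exact intervalIntegral.integral_hasDerivWithinAt_right
      ((hlam.mono (Icc_subset_Icc_right ht.2)).intervalIntegrable_of_Icc ht.1)
      (hlam.stronglyMeasurableAtFilter_nhdsWithin measurableSet_Icc t) (hlam t ht)
  refine eqOn_Icc_of_hasDerivWithinAt_smul hD hg hlam hu
    (v := fun t => x (∫ r in t₀..t, lam r)) (fun t ht => ?_) ?_ (right_mem_Icc.2 h₀₁)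
  · have := hx _ (hnonneg t ht)
    exact ⟨this.1, this.2.scomp t (hderiv t ht) hnonneg⟩
  · simpa using h₀

theorem hasDerivAt_ite_lt_of_tendsto {y y' γ : ℝ → E} {T : ℝ} {e : E}
    (hy : ∀ᶠ t in 𝓝[<] T, HasDerivAt y (y' t) t) (hlim : Tendsto y (𝓝[<] T) (𝓝 (γ T)))
    (hy' : Tendsto y' (𝓝[<] T) (𝓝 e)) (hγ : HasDerivAt γ e T) :
    HasDerivAt (fun t => if t < T then y t else γ t) e T := by
  have heq : ∀ t < T, (fun t => if t < T then y t else γ t) t = y t := fun t ht => if_pos ht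
  have hderiv : ∀ᶠ t in 𝓝[<] T, HasDerivAt (fun t => if t < T then y t else γ t) (y' t) t := by
    filter_upwards [hy, self_mem_nhdsWithin] with t hyt ht
    exact hyt.congr_of_eventuallyEq ((eventually_lt_nhds ht).mono heq)
  have hleft : HasDerivWithinAt (fun t => if t < T then y t else γ t) e (Iic T) T := by
    refine hasDerivWithinAt_Iic_of_tendsto_deriv
      (s := {t | HasDerivAt (fun t => if t < T then y t else γ t) (y' t) t ∧ t < T})
      (fun t ht => ht.1.differentiableAt.differentiableWithinAt) ?_
      (hderiv.and self_mem_nhdsWithin) (hy'.congr' (hderiv.mono fun t ht => ht.deriv.symm))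
    simp only [ContinuousWithinAt, lt_irrefl, if_false]
    refine (hlim.congr' ?_).mono_left (nhdsWithin_mono _ fun t ht => ht.2)
    filter_upwards [self_mem_nhdsWithin] with t ht using (heq t ht).symm
  have hright : HasDerivWithinAt (fun t => if t < T then y t else γ t) e (Ici T) T :=
    hγ.hasDerivWithinAt.congr (fun t ht => if_neg (not_lt.2 ht)) (if_neg (lt_irrefl T))
  simpa [Iic_union_Ici] using hleft.union hright

variable {n : ℕ} {f : (Fin n → ℝ) → (Fin n → ℝ)} {U : Set (Fin n → ℝ)} {y : ℝ → Fin n → ℝ}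

theorem IsSolutionOn.mem_and_hasDerivAt {t₀ t : ℝ} {T : EReal} (hy : IsSolutionOn f U y t₀ T)
    (ht₀ : t₀ < t) (ht : (t : EReal) < T) : y t ∈ U ∧ HasDerivAt y (f (y t)) t :=
  (hy t ht₀.le ht).imp_right fun h => h.hasDerivAt (Ici_mem_nhds ht₀)

theorem IsSolutionOn.ite_lt {t₀ T T' : ℝ} (hf : ContinuousOn f U) (hU : IsOpen U)
    (hy : IsSolutionOn f U y t₀ T) (ht₀ : t₀ < T) {γ : ℝ → Fin n → ℝ}
    (hγ : ∀ t ∈ Ico T T', γ t ∈ U ∧ HasDerivAt γ (f (γ t)) t)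
    (hlim : Tendsto y (𝓝[<] T) (𝓝 (γ T))) :
    IsSolutionOn f U (fun t => if t < T then y t else γ t) t₀ T' := by
  intro t h₀t htT'
  rcases lt_trichotomy t T with ht | rfl | ht
  · have := hy t h₀t (EReal.coe_lt_coe ht)
    simp only [if_pos ht]
    refine ⟨this.1, this.2.congr_of_eventuallyEq ?_ (if_pos ht)⟩
    exact mem_nhdsWithin_of_mem_nhds ((eventually_lt_nhds ht).mono fun r hr => if_pos hr)
  · have hγt := hγ t ⟨le_rfl, EReal.coe_lt_coe_iff.1 htT'⟩
    have hev : ∀ᶠ r in 𝓝[<] t, HasDerivAt y (f (y r)) r := by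
      filter_upwards [Ioo_mem_nhdsLT ht₀] with r hr
      exact (hy.mem_and_hasDerivAt hr.1 (EReal.coe_lt_coe hr.2)).2
    simp only [lt_irrefl, if_false]
    exact ⟨hγt.1, (hasDerivAt_ite_lt_of_tendsto hev hlim
      ((hf.continuousAt (hU.mem_nhds hγt.1)).tendsto.comp hlim) hγt.2).hasDerivWithinAt⟩
  · have hγt := hγ t ⟨ht.le, EReal.coe_lt_coe_iff.1 htT'⟩
    simp only [if_neg ht.not_gt]
    exact ⟨hγt.1, (hγt.2.congr_of_eventuallyEq ((eventually_gt_nhds ht).mono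
      fun r hr => if_neg (lt_asymm hr))).hasDerivWithinAt⟩

theorem IsMaximalSolution.not_tendsto (hU : IsOpen U) (hf : ContDiffOn ℝ 1 f U) {t₀ T : ℝ}
    (hy : IsMaximalSolution f U y t₀ T) {y₁ : Fin n → ℝ} (hy₁ : y₁ ∈ U) :
    ¬ Tendsto y (𝓝[<] T) (𝓝 y₁) := fun hlim => by
  obtain ⟨γ, rfl, ε, hε, hγ⟩ := (hf.contDiffAt
    (hU.mem_nhds hy₁)).exists_forall_mem_closedBall_exists_eq_forall_mem_Ioo_hasDerivAt₀ T
  have hγU : ∀ᶠ t in 𝓝 T, γ t ∈ U :=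
    (hγ T ⟨by linarith, by linarith⟩).continuousAt.eventually_mem (hU.mem_nhds hy₁)
  obtain ⟨δ, hδ, hball⟩ := Metric.eventually_nhds_iff.1 hγU
  have hsol := hy.solution.ite_lt (T' := T + min ε δ) hf.continuousOn hU
    (EReal.coe_lt_coe_iff.1 hy.lt)
    (fun t ht => ⟨hball (by
        rw [Real.dist_eq, abs_of_nonneg (sub_nonneg.2 ht.1)]
        linarith [ht.2, min_le_right ε δ]),
      hγ t ⟨by linarith [ht.1], by linarith [ht.2, min_le_left ε δ]⟩⟩) hlim
  have hle := hy.maximal _ _ hsol fun t _ ht => if_pos (EReal.coe_lt_coe_iff.1 ht)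
  linarith [EReal.coe_le_coe_iff.1 hle, lt_min hε hδ]

end ODE

section Compactification

theorem rpow_one_div_two_mul_pow {r : ℝ} (hr : 0 ≤ r) {c : ℕ} (hc : c ≠ 0) :
    (r ^ (1 / (2 * c : ℝ))) ^ (2 * c) = r := by
  simpa using Real.rpow_inv_natCast_pow hr (mul_ne_zero two_ne_zero hc)

theorem pow_rpow_one_div_two_mul {r : ℝ} (hr : 0 ≤ r) {c : ℕ} (hc : c ≠ 0) :
    (r ^ (2 * c)) ^ (1 / (2 * c : ℝ)) = r := by
  simpa using Real.pow_rpow_inv_natCast hr (mul_ne_zero two_ne_zero hc)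

variable {n : ℕ}

/-- The polynomial `p ^ (2 c)`: the horizon is its level set `1`. Unlike `p`, it is smooth at the
zeros of `p`. -/
noncomputable def horizonPoly (α β : Fin n → ℕ) (a x : Fin n → ℝ) : ℝ :=
  ∑ i ∈ homIndices α, a i * x i ^ (2 * β i)

/-- The inverse `x ↦ (κ^{α_1} x_1, …, κ^{α_n} x_n)` of the compactification `T_{qP}`, where `κ` is
expressed in the `x`-coordinate. -/
noncomputable def compactificationInv (α β : Fin n → ℕ) (c : ℕ) (a x : Fin n → ℝ) : Fin n → ℝ :=
  scale α (kappaX α β c a x) x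

variable {α β : Fin n → ℕ} {c : ℕ} {a : Fin n → ℝ} {W : Set ({i : Fin n // α i = 0} → ℝ)}

theorem mem_homIndices {i : Fin n} : i ∈ homIndices α ↔ 0 < α i := by
  simp [homIndices]

theorem scale_scale (R S : ℝ) (x : Fin n → ℝ) : scale α R (scale α S x) = scale α (R * S) x := by
  ext i
  simp only [scale, mul_pow, mul_assoc]

theorem scale_mem_admissibleDomain_iff {R : ℝ} {x : Fin n → ℝ} :
    scale α R x ∈ admissibleDomain α W ↔ x ∈ admissibleDomain α W := by
  have : (fun j : {i : Fin n // α i = 0} => scale α R x j) =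
      fun j : {i : Fin n // α i = 0} => x j := by
    ext j
    simp [scale, j.2]
  simp only [admissibleDomain, mem_ofPred_eq, this]

theorem isOpen_admissibleDomain (hW : IsOpen W) : IsOpen (admissibleDomain α W) :=
  hW.preimage (continuous_pi fun _ => continuous_apply _)

theorem contDiff_horizonPoly : ContDiff ℝ ∞ (horizonPoly α β a) := by
  unfold horizonPoly
  fun_prop

theorem continuous_horizonPoly : Continuous (horizonPoly α β a) := contDiff_horizonPoly.continuous

theorem kappaX_pos {x : Fin n → ℝ} (hx : horizonPoly α β a x < 1) : 0 < kappaX α β c a x :=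
  Real.rpow_pos_of_pos (sub_pos.2 hx) _

theorem kappaX_pow {x : Fin n → ℝ} (hc : c ≠ 0) (hx : horizonPoly α β a x < 1) :
    kappaX α β c a x ^ (2 * c) = (1 - horizonPoly α β a x)⁻¹ := by
  have h1 : 0 ≤ 1 - horizonPoly α β a x := (sub_pos.2 hx).le
  change ((1 - horizonPoly α β a x) ^ (-(1 / (2 * c : ℝ)))) ^ (2 * c) = _
  rw [Real.rpow_neg h1, inv_pow, rpow_one_div_two_mul_pow h1 hc]

theorem contDiffOn_kappaX : ContDiffOn ℝ ∞ (kappaX α β c a) {x | horizonPoly α β a x < 1} :=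
  (contDiffOn_const.sub contDiff_horizonPoly.contDiffOn).rpow_const_of_ne
    fun _ hx => (sub_pos.2 hx).ne'

theorem contDiffOn_compactificationInv :
    ContDiffOn ℝ ∞ (compactificationInv α β c a) {x | horizonPoly α β a x < 1} :=
  contDiffOn_pi.2 fun i => (contDiffOn_kappaX.pow (α i)).mul (contDiff_apply ℝ ℝ i).contDiffOn

namespace IsCompactificationData

theorem beta_pos (h : IsCompactificationData α β c a) {i : Fin n} (hi : i ∈ homIndices α) :
    0 < β i :=
  Nat.pos_of_ne_zero fun h0 => by simpa [h0, h.c_pos.ne] using h.mul_eq i hi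

theorem horizonPoly_nonneg (h : IsCompactificationData α β c a) (x : Fin n → ℝ) :
    0 ≤ horizonPoly α β a x :=
  Finset.sum_nonneg fun i _ =>
    mul_nonneg (zero_le_one.trans (h.one_le_a i)) ((even_two_mul _).pow_nonneg _)

theorem p_nonneg (h : IsCompactificationData α β c a) (x : Fin n → ℝ) : 0 ≤ p α β c a x :=
  Real.rpow_nonneg (h.horizonPoly_nonneg x) _

theorem p_pow (h : IsCompactificationData α β c a) (x : Fin n → ℝ) :
    p α β c a x ^ (2 * c) = horizonPoly α β a x :=
  rpow_one_div_two_mul_pow (h.horizonPoly_nonneg x) h.c_pos.ne'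

theorem two_mul_c_ne_zero (h : IsCompactificationData α β c a) : 2 * c ≠ 0 :=
  mul_ne_zero two_ne_zero h.c_pos.ne'

theorem p_lt_one_iff (h : IsCompactificationData α β c a) {x : Fin n → ℝ} :
    p α β c a x < 1 ↔ horizonPoly α β a x < 1 := by
  rw [← h.p_pow x, pow_lt_one_iff_of_nonneg (h.p_nonneg x) h.two_mul_c_ne_zero]

theorem p_eq_one_iff (h : IsCompactificationData α β c a) {x : Fin n → ℝ} :
    p α β c a x = 1 ↔ horizonPoly α β a x = 1 := by
  rw [← h.p_pow x, pow_eq_one_iff_of_nonneg (h.p_nonneg x) h.two_mul_c_ne_zero]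

theorem kappa_eq (h : IsCompactificationData α β c a) (y : Fin n → ℝ) :
    kappa α β c a y = (1 + horizonPoly α β a y) ^ (1 / (2 * c : ℝ)) := by
  rw [kappa, h.p_pow]

theorem one_add_horizonPoly_pos (h : IsCompactificationData α β c a) (y : Fin n → ℝ) :
    0 < 1 + horizonPoly α β a y :=
  add_pos_of_pos_of_nonneg one_pos (h.horizonPoly_nonneg y)

theorem one_le_kappa (h : IsCompactificationData α β c a) (y : Fin n → ℝ) :
    1 ≤ kappa α β c a y := by
  rw [h.kappa_eq]
  exact Real.one_le_rpow (le_add_of_nonneg_right (h.horizonPoly_nonneg y)) (by positivity)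

theorem kappa_pos (h : IsCompactificationData α β c a) (y : Fin n → ℝ) : 0 < kappa α β c a y :=
  one_pos.trans_le (h.one_le_kappa y)

theorem kappa_pow (h : IsCompactificationData α β c a) (y : Fin n → ℝ) :
    kappa α β c a y ^ (2 * c) = 1 + horizonPoly α β a y := by
  rw [h.kappa_eq, rpow_one_div_two_mul_pow (h.one_add_horizonPoly_pos y).le h.c_pos.ne']

theorem continuous_kappa (h : IsCompactificationData α β c a) : Continuous (kappa α β c a) := by
  rw [funext h.kappa_eq]
  exact (continuous_const.add continuous_horizonPoly).rpow_const fun y =>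
    Or.inl (h.one_add_horizonPoly_pos y).ne'

theorem horizonPoly_scale (h : IsCompactificationData α β c a) (R : ℝ) (x : Fin n → ℝ) :
    horizonPoly α β a (scale α R x) = R ^ (2 * c) * horizonPoly α β a x := by
  simp only [horizonPoly, scale, Finset.mul_sum]
  refine Finset.sum_congr rfl fun i hi => ?_
  rw [← h.mul_eq i hi]
  ring

theorem p_scale (h : IsCompactificationData α β c a) {R : ℝ} (hR : 0 ≤ R) (x : Fin n → ℝ) :
    p α β c a (scale α R x) = R * p α β c a x := by
  change horizonPoly α β a (scale α R x) ^ (1 / (2 * c : ℝ)) =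
    R * horizonPoly α β a x ^ (1 / (2 * c : ℝ))
  rw [h.horizonPoly_scale, Real.mul_rpow (by positivity) (h.horizonPoly_nonneg x),
    pow_rpow_one_div_two_mul hR h.c_pos.ne']

theorem scale_kappa_compactification (h : IsCompactificationData α β c a) (y : Fin n → ℝ) :
    scale α (kappa α β c a y) (compactification α β c a y) = y :=
  funext fun i => mul_div_cancel₀ (y i) (pow_ne_zero (α i) (h.kappa_pos y).ne')

theorem one_sub_horizonPoly_compactification (h : IsCompactificationData α β c a)
    (y : Fin n → ℝ) :
    1 - horizonPoly α β a (compactification α β c a y) = (kappa α β c a y ^ (2 * c))⁻¹ := by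
  have hpow := h.kappa_pow y
  have hscale := h.horizonPoly_scale (kappa α β c a y) (compactification α β c a y)
  rw [h.scale_kappa_compactification] at hscale
  refine eq_inv_of_mul_eq_one_left ?_
  linear_combination hpow + hscale

theorem horizonPoly_compactification_lt_one (h : IsCompactificationData α β c a)
    (y : Fin n → ℝ) : horizonPoly α β a (compactification α β c a y) < 1 := by
  rw [← sub_pos, h.one_sub_horizonPoly_compactification]
  exact inv_pos.2 (pow_pos (h.kappa_pos y) _)

theorem kappaX_compactification (h : IsCompactificationData α β c a) (y : Fin n → ℝ) :
    kappaX α β c a (compactification α β c a y) = kappa α β c a y := by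
  have hlt := h.horizonPoly_compactification_lt_one y
  refine (pow_left_inj₀ (kappaX_pos hlt).le (h.kappa_pos y).le h.two_mul_c_ne_zero).1 ?_
  rw [kappaX_pow h.c_pos.ne' hlt, h.one_sub_horizonPoly_compactification, inv_inv]

theorem kappa_compactificationInv (h : IsCompactificationData α β c a) {x : Fin n → ℝ}
    (hx : horizonPoly α β a x < 1) :
    kappa α β c a (compactificationInv α β c a x) = kappaX α β c a x := by
  refine (pow_left_inj₀ (h.kappa_pos _).le (kappaX_pos hx).le h.two_mul_c_ne_zero).1 ?_
  rw [h.kappa_pow, compactificationInv, h.horizonPoly_scale, kappaX_pow h.c_pos.ne' hx]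
  field_simp [(sub_pos.2 hx).ne']
  ring

theorem compactificationInv_compactification (h : IsCompactificationData α β c a)
    (y : Fin n → ℝ) : compactificationInv α β c a (compactification α β c a y) = y := by
  rw [compactificationInv, h.kappaX_compactification, h.scale_kappa_compactification]

theorem compactification_compactificationInv (h : IsCompactificationData α β c a)
    {x : Fin n → ℝ} (hx : horizonPoly α β a x < 1) :
    compactification α β c a (compactificationInv α β c a x) = x := by
  ext i
  rw [compactification, h.kappa_compactificationInv hx]
  exact mul_div_cancel_left₀ (x i) (pow_ne_zero (α i) (kappaX_pos hx).ne')

theorem disc_eq (h : IsCompactificationData α β c a) (W : Set ({i : Fin n // α i = 0} → ℝ)) :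
    disc α β c a W = admissibleDomain α W ∩ {x | horizonPoly α β a x < 1} := by
  ext x
  simp only [disc, mem_ofPred_eq, h.p_lt_one_iff, mem_inter_iff]
  refine and_congr_left fun hx => ⟨?_, fun hxU => ?_⟩
  · rintro ⟨y, hy, rfl⟩
    rwa [← scale_mem_admissibleDomain_iff, h.scale_kappa_compactification]
  · exact ⟨_, scale_mem_admissibleDomain_iff.2 hxU, h.compactification_compactificationInv hx⟩

theorem closedDisc_eq (h : IsCompactificationData α β c a)
    (W : Set ({i : Fin n // α i = 0} → ℝ)) :
    closedDisc α β c a W = admissibleDomain α W ∩ {x | horizonPoly α β a x ≤ 1} := by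
  ext x
  simp only [closedDisc, h.disc_eq, horizon, mem_union, mem_inter_iff, mem_ofPred_eq,
    h.p_eq_one_iff, ← and_or_left, le_iff_lt_or_eq]

theorem isOpen_disc (h : IsCompactificationData α β c a) (hW : IsOpen W) :
    IsOpen (disc α β c a W) := by
  rw [h.disc_eq]
  exact (isOpen_admissibleDomain hW).inter (isOpen_lt continuous_horizonPoly continuous_const)

theorem compactification_mem_disc (h : IsCompactificationData α β c a) {y : Fin n → ℝ}
    (hy : y ∈ admissibleDomain α W) : compactification α β c a y ∈ disc α β c a W :=
  ⟨mem_image_of_mem _ hy, h.p_lt_one_iff.2 (h.horizonPoly_compactification_lt_one y)⟩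

theorem tendsto_kappaX_atTop (h : IsCompactificationData α β c a) {x : Fin n → ℝ}
    (hx : x ∈ horizon α β c a W) :
    Tendsto (kappaX α β c a) (𝓝[disc α β c a W] x) atTop := by
  have hx1 : horizonPoly α β a x = 1 := h.p_eq_one_iff.1 hx.2
  have hzero : Tendsto (fun z => 1 - horizonPoly α β a z) (𝓝[disc α β c a W] x) (𝓝[>] 0) := by
    refine tendsto_nhdsWithin_iff.2 ⟨?_, ?_⟩
    · have := (continuous_horizonPoly (α := α) (β := β) (a := a)).tendsto x |>.const_sub 1
      rw [hx1, sub_self] at this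
      exact this.mono_left nhdsWithin_le_nhds
    · filter_upwards [self_mem_nhdsWithin] with z hz
      exact sub_pos.2 (h.p_lt_one_iff.1 hz.2)
  have hexp : -(1 / (2 * c : ℝ)) < 0 := by
    have := h.c_pos
    simp only [neg_lt_zero]; positivity
  exact (tendsto_rpow_neg_nhdsGT_zero hexp).comp hzero

end IsCompactificationData

end Compactification

section Dynamics

variable {n : ℕ}

/-- The sum `∑ β_j a_j x_j ^ (2 β_j - 1) f̃_j(x)` in the definition of `g`, half the derivative of
`p ^ (2 c)` in the direction `f̃`. It is the growth rate of `κ ^ c` in the desingularized time. -/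
noncomputable def radialRate (α β : Fin n → ℕ) (c : ℕ) (a : Fin n → ℝ) (k : ℕ)
    (f fα : (Fin n → ℝ) → (Fin n → ℝ)) (x : Fin n → ℝ) : ℝ :=
  ∑ j ∈ homIndices α, β j * a j * x j ^ (2 * β j - 1) * fTilde α β c a k f fα x j

/-- The Euler field `(α_1 x_1, …, α_n x_n)`, the infinitesimal generator of the quasi-homogeneous
scaling. -/
def eulerField (α : Fin n → ℕ) (x : Fin n → ℝ) : Fin n → ℝ :=
  fun i => α i * x i

variable {α β : Fin n → ℕ} {c : ℕ} {a : Fin n → ℝ} {k : ℕ} {f fα : (Fin n → ℝ) → (Fin n → ℝ)}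

theorem hasFDerivAt_horizonPoly (x : Fin n → ℝ) :
    HasFDerivAt (horizonPoly α β a) (fderiv ℝ (horizonPoly α β a) x) x :=
  (contDiff_horizonPoly.differentiable (by simp)).differentiableAt.hasFDerivAt

theorem fderiv_horizonPoly_apply (x v : Fin n → ℝ) :
    fderiv ℝ (horizonPoly α β a) x v =
      2 * ∑ j ∈ homIndices α, β j * a j * x j ^ (2 * β j - 1) * v j := by
  have h : HasFDerivAt (horizonPoly α β a) (∑ i ∈ homIndices α,
      a i • (((2 * β i : ℕ) * x i ^ (2 * β i - 1)) •
        (ContinuousLinearMap.proj i : (Fin n → ℝ) →L[ℝ] ℝ))) x := by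
    unfold horizonPoly
    refine HasFDerivAt.fun_sum fun i _ => HasFDerivAt.const_mul ?_ _
    exact (hasDerivAt_pow (2 * β i) (x i)).comp_hasFDerivAt x
      (ContinuousLinearMap.proj i : (Fin n → ℝ) →L[ℝ] ℝ).hasFDerivAt
  rw [h.fderiv, Finset.mul_sum]
  simp only [sum_apply, smul_apply, ContinuousLinearMap.proj_apply, smul_eq_mul]
  refine Finset.sum_congr rfl fun i _ => ?_
  push_cast
  ring

theorem fderiv_horizonPoly_fTilde (x : Fin n → ℝ) :
    fderiv ℝ (horizonPoly α β a) x (fTilde α β c a k f fα x) =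
      2 * radialRate α β c a k f fα x :=
  fderiv_horizonPoly_apply _ _

namespace IsCompactificationData

theorem fderiv_horizonPoly_eulerField (h : IsCompactificationData α β c a) (x : Fin n → ℝ) :
    fderiv ℝ (horizonPoly α β a) x (eulerField α x) = 2 * c * horizonPoly α β a x := by
  rw [fderiv_horizonPoly_apply, horizonPoly, mul_assoc, Finset.mul_sum _ _ (c : ℝ)]
  congr 1
  refine Finset.sum_congr rfl fun i hi => ?_
  rw [← h.mul_eq i hi, eulerField, ← mul_pow_sub_one (mul_pos two_pos (h.beta_pos hi)).ne' (x i)]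
  push_cast
  ring

theorem fderiv_horizonPoly_scale (h : IsCompactificationData α β c a) (R : ℝ)
    (x v : Fin n → ℝ) :
    fderiv ℝ (horizonPoly α β a) (scale α R x) (scale α R v) =
      R ^ (2 * c) * fderiv ℝ (horizonPoly α β a) x v := by
  simp only [fderiv_horizonPoly_apply, Finset.mul_sum, scale]
  refine Finset.sum_congr rfl fun i hi => ?_
  rw [← h.mul_eq i hi, mul_left_comm 2 (α i) (β i), pow_mul,
    ← mul_pow_sub_one (mul_pos two_pos (h.beta_pos hi)).ne' (R ^ α i)]
  ring

theorem desingularized_eq (h : IsCompactificationData α β c a) (x : Fin n → ℝ) :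
    desingularized α β c a k f fα x =
      fTilde α β c a k f fα x - (radialRate α β c a k f fα x / c) • eulerField α x := by
  ext i
  simp only [desingularized, Pi.sub_apply, Pi.smul_apply, smul_eq_mul, eulerField]
  split_ifs with hi
  · have hα : (α i : ℝ) ≠ 0 := Nat.cast_ne_zero.2 (mem_homIndices.1 hi).ne'
    have hβ : (β i : ℝ) ≠ 0 := Nat.cast_ne_zero.2 (h.beta_pos hi).ne'
    rw [← h.mul_eq i hi, Nat.cast_mul, radialRate]
    field_simp
  · simp [Nat.eq_zero_of_not_pos (mt mem_homIndices.2 hi)]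

theorem fderiv_horizonPoly_desingularized (h : IsCompactificationData α β c a)
    (x : Fin n → ℝ) :
    fderiv ℝ (horizonPoly α β a) x (desingularized α β c a k f fα x) =
      2 * radialRate α β c a k f fα x * (1 - horizonPoly α β a x) := by
  have hc : (c : ℝ) ≠ 0 := Nat.cast_ne_zero.2 h.c_pos.ne'
  rw [h.desingularized_eq, map_sub, map_smul, fderiv_horizonPoly_fTilde,
    h.fderiv_horizonPoly_eulerField, smul_eq_mul]
  field_simp

theorem apply_eq_smul_scale_fTilde (h : IsCompactificationData α β c a) (y : Fin n → ℝ) :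
    f y = kappa α β c a y ^ k •
      scale α (kappa α β c a y) (fTilde α β c a k f fα (compactification α β c a y)) := by
  ext j
  have hκ := (h.kappa_pos y).ne'
  simp only [Pi.smul_apply, scale, smul_eq_mul, fTilde, h.kappaX_compactification,
    if_pos (h.p_lt_one_iff.2 (h.horizonPoly_compactification_lt_one y))]
  rw [h.scale_kappa_compactification]
  field_simp
  ring

theorem fderiv_horizonPoly_field (h : IsCompactificationData α β c a) (y : Fin n → ℝ) :
    fderiv ℝ (horizonPoly α β a) y (f y) = 2 * kappa α β c a y ^ (2 * c + k) *
      radialRate α β c a k f fα (compactification α β c a y) := by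
  have hscale := h.fderiv_horizonPoly_scale (kappa α β c a y) (compactification α β c a y)
    (fTilde α β c a k f fα (compactification α β c a y))
  rw [h.scale_kappa_compactification, fderiv_horizonPoly_fTilde] at hscale
  rw [h.apply_eq_smul_scale_fTilde (k := k) (f := f) (fα := fα), map_smul, hscale, smul_eq_mul]
  ring

variable {y x : ℝ → Fin n → ℝ} {s : Set ℝ} {t : ℝ}

theorem hasDerivWithinAt_kappa (h : IsCompactificationData α β c a)
    (hy : HasDerivWithinAt y (f (y t)) s t) :
    HasDerivWithinAt (fun r => kappa α β c a (y r)) (kappa α β c a (y t) ^ (k + 1) *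
      radialRate α β c a k f fα (compactification α β c a (y t)) / c) s t := by
  have hc : (c : ℝ) ≠ 0 := Nat.cast_ne_zero.2 h.c_pos.ne'
  have hpos := h.one_add_horizonPoly_pos (y t)
  have hroot := (((hasFDerivAt_horizonPoly (α := α) (β := β) (a := a)
    (y t)).comp_hasDerivWithinAt t hy).const_add 1).rpow_const (p := 1 / (2 * c : ℝ))
    (Or.inl hpos.ne')
  simp only [Function.comp_def, ← h.kappa_eq] at hroot
  refine hroot.congr_deriv ?_
  rw [h.fderiv_horizonPoly_field (fα := fα) (k := k), Real.rpow_sub hpos, Real.rpow_one,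
    ← h.kappa_eq, ← h.kappa_pow]
  have := (h.kappa_pos (y t)).ne'
  field_simp
  ring

theorem hasDerivWithinAt_compactification (h : IsCompactificationData α β c a)
    (hy : HasDerivWithinAt y (f (y t)) s t) :
    HasDerivWithinAt (fun r => compactification α β c a (y r)) (kappa α β c a (y t) ^ k •
      desingularized α β c a k f fα (compactification α β c a (y t))) s t := by
  refine hasDerivWithinAt_pi.2 fun i => ?_
  have hκ := (h.kappa_pos (y t)).ne'
  have hquot := (hasDerivWithinAt_pi.1 hy i).div ((h.hasDerivWithinAt_kappa (fα := fα) (k := k)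
    hy).fun_pow (α i)) (pow_ne_zero _ hκ)
  refine hquot.congr_deriv ?_
  rw [h.apply_eq_smul_scale_fTilde (k := k) (f := f) (fα := fα), h.desingularized_eq]
  simp only [Pi.smul_apply, Pi.sub_apply, smul_eq_mul, scale, eulerField]
  have hyi : y t i = kappa α β c a (y t) ^ α i * compactification α β c a (y t) i :=
    (congrFun (h.scale_kappa_compactification (y t)) i).symm
  rw [hyi]
  have hc : (c : ℝ) ≠ 0 := Nat.cast_ne_zero.2 h.c_pos.ne'
  rcases Nat.eq_zero_or_pos (α i) with hα | hα
  · simp [hα]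
  · rw [← mul_pow_sub_one hα.ne' (kappa α β c a (y t))]
    field_simp
    ring

theorem hasDerivWithinAt_inv_kappa_pow (h : IsCompactificationData α β c a)
    (hy : HasDerivWithinAt y (f (y t)) s t) :
    HasDerivWithinAt (fun r => (kappa α β c a (y r) ^ k)⁻¹)
      (-(k / c * radialRate α β c a k f fα (compactification α β c a (y t)))) s t := by
  have hκ := (h.kappa_pos (y t)).ne'
  have hc : (c : ℝ) ≠ 0 := Nat.cast_ne_zero.2 h.c_pos.ne'
  refine (((h.hasDerivWithinAt_kappa (fα := fα) (k := k) hy).fun_pow k).fun_inv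
    (pow_ne_zero _ hκ)).congr_deriv ?_
  cases k with
  | zero => simp
  | succ m =>
    rw [Nat.add_sub_cancel]
    field_simp
    ring

theorem hasDerivWithinAt_one_sub_horizonPoly (h : IsCompactificationData α β c a)
    (hx : HasDerivWithinAt x (desingularized α β c a k f fα (x t)) s t) :
    HasDerivWithinAt (fun r => 1 - horizonPoly α β a (x r))
      (-2 * radialRate α β c a k f fα (x t) * (1 - horizonPoly α β a (x t))) s t := by
  refine (((hasFDerivAt_horizonPoly (x t)).comp_hasDerivWithinAt t hx).const_sub 1).congr_deriv ?_
  rw [h.fderiv_horizonPoly_desingularized]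
  ring

end IsCompactificationData

end Dynamics

section Regularity

variable {n : ℕ}

/-- The error of the approximation of `f` by its quasi-homogeneous part at scale `R`, in the
normalization in which it tends to `0` uniformly on the sphere. -/
noncomputable def asymptoticError (α : Fin n → ℕ) (k : ℕ) (f fα : (Fin n → ℝ) → (Fin n → ℝ))
    (R : ℝ) (x : Fin n → ℝ) (j : Fin n) : ℝ :=
  (R ^ (k + α j))⁻¹ * (f (scale α R x) j - R ^ (k + α j) * fα x j)

variable {α β : Fin n → ℕ} {c : ℕ} {a : Fin n → ℝ} {k : ℕ}
  {W : Set ({i : Fin n // α i = 0} → ℝ)} {f fα : (Fin n → ℝ) → (Fin n → ℝ)}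

theorem IsQuasiHomogeneous.asymptoticError_scale {U : Set (Fin n → ℝ)}
    (hfα : IsQuasiHomogeneous α k U fα) {x : Fin n → ℝ} (hx : x ∈ U) {ρ : ℝ} (hρ : ρ ≠ 0) (R : ℝ)
    (j : Fin n) :
    asymptoticError α k f fα R (scale α ρ x) j =
      ρ ^ (k + α j) * asymptoticError α k f fα (R * ρ) x j := by
  simp only [asymptoticError, scale_scale, hfα.homogeneous x hx, mul_pow]
  field_simp

theorem exists_eventually_scale_mem_sphere {x : Fin n → ℝ}
    (hx : ∃ i ∈ homIndices α, x i ≠ 0) :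
    ∃ ρ₁ ρ₂ : ℝ, 0 < ρ₁ ∧ ∀ᶠ z in 𝓝 x, ∃ ρ ∈ Icc ρ₁ ρ₂,
      ∑ i ∈ homIndices α, scale α ρ z i ^ 2 = 1 := by
  obtain ⟨i, hi, hxi⟩ := hx
  set φ : ℝ → (Fin n → ℝ) → ℝ := fun ρ z => ∑ i ∈ homIndices α, scale α ρ z i ^ 2
  have hφρ : ∀ z, Continuous fun ρ => φ ρ z := fun z => by
    simp only [φ, scale]
    fun_prop
  have hφz : ∀ ρ, Continuous (φ ρ) := fun ρ => by
    simp only [φ, scale]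
    fun_prop
  have hφ_zero : φ 0 x = 0 := Finset.sum_eq_zero fun i hi => by
    simp [scale, (mem_homIndices.1 hi).ne']
  have hφ_atTop : Tendsto (fun ρ => φ ρ x) atTop atTop := by
    have hterm : Tendsto (fun ρ : ℝ => scale α ρ x i ^ 2) atTop atTop := by
      simp only [scale, mul_pow, ← pow_mul]
      exact (tendsto_pow_atTop (mul_pos (mem_homIndices.1 hi) two_pos).ne').atTop_mul_const
        (by positivity)
    exact tendsto_atTop_mono (fun ρ => Finset.single_le_sum
      (f := fun i => scale α ρ x i ^ 2) (fun _ _ => sq_nonneg _) hi) hterm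
  obtain ⟨ρ₁, hρ₁, hρ₁_pos⟩ : ∃ ρ₁, φ ρ₁ x < 1 ∧ 0 < ρ₁ :=
    (((hφρ x).tendsto' 0 0 hφ_zero).mono_left nhdsWithin_le_nhds
      |>.eventually_lt_const one_pos |>.and self_mem_nhdsWithin).exists (f := 𝓝[>] (0 : ℝ))
  obtain ⟨ρ₂, hρ₂, hρ₁₂⟩ : ∃ ρ₂, 1 < φ ρ₂ x ∧ ρ₁ ≤ ρ₂ :=
    ((hφ_atTop.eventually_gt_atTop 1).and (eventually_ge_atTop ρ₁)).exists
  refine ⟨ρ₁, ρ₂, hρ₁_pos, ?_⟩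
  filter_upwards [(hφz ρ₁).continuousAt.eventually_lt_const hρ₁,
    (hφz ρ₂).continuousAt.eventually_const_lt hρ₂] with z hz₁ hz₂
  exact intermediate_value_Icc hρ₁₂ (hφρ z).continuousOn ⟨hz₁.le, hz₂.le⟩

/-- Homogeneity transports the uniform estimate on the unit sphere to a locally uniform one. -/
theorem IsAsymptoticallyQuasiHomogeneous.tendsto_asymptoticError
    (hf : IsAsymptoticallyQuasiHomogeneous α k W f fα) {x : Fin n → ℝ}
    (hx : ∃ i ∈ homIndices α, x i ≠ 0) (j : Fin n) :
    Tendsto (fun q : ℝ × (Fin n → ℝ) => asymptoticError α k f fα q.1 q.2 j)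
      (atTop ×ˢ 𝓝[admissibleDomain α W] x) (𝓝 0) := by
  obtain ⟨ρ₁, ρ₂, hρ₁, hsphere⟩ := exists_eventually_scale_mem_sphere hx
  refine Metric.tendsto_nhds.2 fun ε hε => ?_
  obtain ⟨R₀, hR₀⟩ := eventually_atTop.1
    (Metric.tendstoUniformlyOn_iff.1 (hf.tendsto j) (ρ₁ ^ (k + α j) * ε) (by positivity))
  filter_upwards [prod_mem_prod (Ici_mem_atTop (|R₀| * ρ₂))
    (inter_mem (mem_nhdsWithin_of_mem_nhds hsphere) self_mem_nhdsWithin)]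
  rintro ⟨R, z⟩ ⟨hR, ⟨ρ, ⟨hρ₁ρ, hρρ₂⟩, hρz⟩, hz⟩
  have hρ : 0 < ρ := hρ₁.trans_le hρ₁ρ
  have hRρ : R₀ ≤ R / ρ := (le_div_iff₀ hρ).2 <|
    calc R₀ * ρ ≤ |R₀| * ρ₂ := by gcongr; exact le_abs_self R₀
      _ ≤ R := hR
  have herr := hR₀ _ hRρ _ ⟨scale_mem_admissibleDomain_iff.2 hz, hρz⟩
  change dist 0 (asymptoticError α k f fα (R / ρ) (scale α ρ z) j) < _ at herr
  rw [hf.quasiHomogeneous.asymptoticError_scale hz hρ.ne', div_mul_cancel₀ _ hρ.ne',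
    dist_comm, dist_zero_right, norm_mul, Real.norm_of_nonneg (by positivity)] at herr
  rw [dist_zero_right]
  refine lt_of_mul_lt_mul_left (herr.trans_le' ?_) (pow_nonneg hρ₁.le (k + α j))
  gcongr

namespace IsCompactificationData

theorem fTilde_eq_add_asymptoticError (h : IsCompactificationData α β c a) {x : Fin n → ℝ}
    (hx : x ∈ disc α β c a W) (j : Fin n) :
    fTilde α β c a k f fα x j =
      fα x j + asymptoticError α k f fα (kappaX α β c a x) x j := by
  have hκ := (kappaX_pos (c := c) (h.p_lt_one_iff.1 hx.2)).ne'
  rw [fTilde, if_pos hx.2, asymptoticError]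
  field_simp
  ring

theorem exists_ne_zero_of_mem_horizon (h : IsCompactificationData α β c a) {x : Fin n → ℝ}
    (hx : x ∈ horizon α β c a W) : ∃ i ∈ homIndices α, x i ≠ 0 := by
  have hx₁ : horizonPoly α β a x ≠ 0 := (h.p_eq_one_iff.1 hx.2).trans_ne one_ne_zero
  obtain ⟨i, hi, hxi⟩ := Finset.exists_ne_zero_of_sum_ne_zero hx₁
  exact ⟨i, hi, fun h0 => hxi (by simp [h0, (h.beta_pos hi).ne'])⟩

theorem contDiffOn_fTilde (h : IsCompactificationData α β c a)
    (hf : ContDiffOn ℝ ∞ f (admissibleDomain α W)) :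
    ContDiffOn ℝ ∞ (fTilde α β c a k f fα) (disc α β c a W) := by
  have hsub : disc α β c a W ⊆ {x | horizonPoly α β a x < 1} :=
    fun x hx => h.p_lt_one_iff.1 hx.2
  have hinv : ContDiffOn ℝ ∞ (f ∘ compactificationInv α β c a) (disc α β c a W) :=
    hf.comp (contDiffOn_compactificationInv.mono hsub) fun x hx =>
      scale_mem_admissibleDomain_iff.2 (h.disc_eq W ▸ hx).1
  refine contDiffOn_pi.2 fun j => ContDiffOn.congr (((contDiffOn_kappaX.mono hsub).pow
    (k + α j) |>.inv fun x hx => ?_).mul (contDiffOn_pi.1 hinv j)) fun x hx => if_pos hx.2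
  exact pow_ne_zero _ (kappaX_pos (hsub hx)).ne'

theorem contDiffOn_desingularized (h : IsCompactificationData α β c a)
    (hf : ContDiffOn ℝ ∞ f (admissibleDomain α W)) :
    ContDiffOn ℝ ∞ (desingularized α β c a k f fα) (disc α β c a W) := by
  have hF := contDiffOn_pi.1 (h.contDiffOn_fTilde (k := k) (fα := fα) hf)
  have hG : ContDiffOn ℝ ∞ (radialRate α β c a k f fα) (disc α β c a W) :=
    ContDiffOn.sum fun j _ => ContDiffOn.mul (ContDiff.contDiffOn (by fun_prop)) (hF j)
  rw [funext h.desingularized_eq]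
  refine (contDiffOn_pi.2 hF).sub ((hG.div_const _).smul (ContDiff.contDiffOn ?_))
  unfold eulerField
  fun_prop

theorem continuousOn_fTilde (h : IsCompactificationData α β c a) (hW : IsOpen W)
    (hf : IsAsymptoticallyQuasiHomogeneous α k W f fα) :
    ContinuousOn (fTilde α β c a k f fα) (closedDisc α β c a W) := by
  have hfα := hf.quasiHomogeneous.smooth.continuousOn
  rintro x (hx | hx)
  · exact ((h.contDiffOn_fTilde hf.smooth).continuousOn.continuousAt
      ((h.isOpen_disc hW).mem_nhds hx)).continuousWithinAt
  · have heq : ∀ z ∈ horizon α β c a W, fTilde α β c a k f fα z = fα z :=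
      fun z hz => funext fun j => if_neg hz.2.not_lt
    have hsub : disc α β c a W ⊆ admissibleDomain α W :=
      fun z hz => (h.disc_eq W ▸ hz).1
    refine ContinuousWithinAt.union ?_ (((hfα.mono fun z hz => hz.1).congr heq) x hx)
    refine continuousWithinAt_pi.2 fun j => ?_
    have herr := (hf.tendsto_asymptoticError (h.exists_ne_zero_of_mem_horizon hx) j).comp
      ((h.tendsto_kappaX_atTop hx).prodMk (tendsto_id.mono_right (nhdsWithin_mono x hsub)))
    have hlim := ((continuousWithinAt_pi.1 (hfα x hx.1) j).mono hsub).tendsto.add herr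
    rw [add_zero] at hlim
    rw [ContinuousWithinAt, heq x hx]
    refine hlim.congr' ?_
    filter_upwards [self_mem_nhdsWithin] with z hz
    exact (h.fTilde_eq_add_asymptoticError hz j).symm

theorem continuousOn_radialRate (h : IsCompactificationData α β c a) (hW : IsOpen W)
    (hf : IsAsymptoticallyQuasiHomogeneous α k W f fα) :
    ContinuousOn (radialRate α β c a k f fα) (closedDisc α β c a W) :=
  continuousOn_finsetSum _ fun j _ => ContinuousOn.mul (Continuous.continuousOn (by fun_prop))
    (continuousOn_pi.1 (h.continuousOn_fTilde hW hf) j)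

end IsCompactificationData

end Regularity

section Equilibrium

variable {n : ℕ} {α β : Fin n → ℕ} {c : ℕ} {a : Fin n → ℝ} {k : ℕ}
  {W : Set ({i : Fin n // α i = 0} → ℝ)} {f fα : (Fin n → ℝ) → (Fin n → ℝ)} {x : Fin n → ℝ}

theorem jacobianWithin_inter {g : (Fin n → ℝ) → (Fin n → ℝ)} {s t : Set (Fin n → ℝ)}
    (hs : s ∈ 𝓝 x) : jacobianWithin g (s ∩ t) x = jacobianWithin g t x := by
  rw [jacobianWithin, inter_comm, fderivWithin_inter hs, jacobianWithin]

namespace IsCompactificationData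

theorem convexOn_horizonPoly (h : IsCompactificationData α β c a) :
    ConvexOn ℝ univ (horizonPoly α β a) := by
  refine ⟨convex_univ, fun x _ z _ r s hr hs hrs => ?_⟩
  simp only [horizonPoly, Finset.smul_sum, ← Finset.sum_add_distrib]
  refine Finset.sum_le_sum fun i _ => ?_
  have hpow := (even_two_mul (β i)).convexOn_pow.2 (mem_univ (x i)) (mem_univ (z i)) hr hs hrs
  have ha : 0 ≤ a i := zero_le_one.trans (h.one_le_a i)
  simp only [Pi.add_apply, Pi.smul_apply, smul_eq_mul] at hpow ⊢
  linarith [mul_le_mul_of_nonneg_left hpow ha]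

theorem uniqueDiffOn_closedDisc (h : IsCompactificationData α β c a) (hW : IsOpen W) :
    UniqueDiffOn ℝ (closedDisc α β c a W) := by
  have hconvex : Convex ℝ {x | horizonPoly α β a x ≤ 1} := by
    simpa using h.convexOn_horizonPoly.convex_le 1
  have hinterior : (interior {x | horizonPoly α β a x ≤ 1}).Nonempty := by
    refine ⟨0, mem_interior.2 ⟨{x | horizonPoly α β a x < 1},
      ofPred_subset_ofPred.2 fun _ => le_of_lt,
      isOpen_lt continuous_horizonPoly continuous_const, ?_⟩⟩
    have hzero : horizonPoly α β a 0 = 0 := Finset.sum_eq_zero fun i hi => by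
      simp [(h.beta_pos hi).ne']
    exact hzero.trans_lt one_pos
  rw [h.closedDisc_eq, inter_comm]
  exact (uniqueDiffOn_convex hconvex hinterior).inter (isOpen_admissibleDomain hW)

theorem fderiv_horizonPoly_ne_zero (h : IsCompactificationData α β c a)
    (hx : x ∈ horizon α β c a W) : fderiv ℝ (horizonPoly α β a) x ≠ 0 := fun hzero => by
  have heuler := h.fderiv_horizonPoly_eulerField x
  rw [hzero, h.p_eq_one_iff.1 hx.2] at heuler
  exact h.c_pos.ne' (by simpa using heuler)

/-- Differentiate `Dq(z) g(z) = 2 G(z) (1 - q(z))` at `x`, where both `g` and `1 - q` vanish;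
`G` need only be continuous. -/
theorem fderiv_horizonPoly_comp_fderivWithin (h : IsCompactificationData α β c a)
    (hW : IsOpen W) (hf : IsAsymptoticallyQuasiHomogeneous α k W f fα)
    (hx : IsEquilibriumAtInfinity α β c a W k f fα x)
    (hg : DifferentiableWithinAt ℝ (desingularized α β c a k f fα) (closedDisc α β c a W) x) :
    (fderiv ℝ (horizonPoly α β a) x).comp
        (fderivWithin ℝ (desingularized α β c a k f fα) (closedDisc α β c a W) x) =
      (-2 * radialRate α β c a k f fα x) • fderiv ℝ (horizonPoly α β a) x := by
  have hmem : x ∈ closedDisc α β c a W := Or.inr hx.1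
  have hd2 : DifferentiableAt ℝ (fderiv ℝ (horizonPoly α β a)) x :=
    (contDiff_infty_iff_fderiv.1 contDiff_horizonPoly).2.differentiable (by simp) x
  have hleft := hd2.hasFDerivAt.hasFDerivWithinAt.clm_apply hg.hasFDerivWithinAt
  simp only [h.fderiv_horizonPoly_desingularized, hx.2, map_zero, add_zero] at hleft
  have hright := hasFDerivWithinAt_smul_of_eq_zero
    ((h.continuousOn_radialRate hW hf x hmem).const_smul (2 : ℝ))
    ((hasFDerivAt_horizonPoly (α := α) (β := β) (a := a) x).const_sub 1).hasFDerivWithinAt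
    (sub_eq_zero.2 (h.p_eq_one_iff.1 hx.1.2).symm)
  ext v
  simpa using DFunLike.congr_fun ((h.uniqueDiffOn_closedDisc hW x hmem).eq hleft hright) v

theorem neg_two_mul_radialRate_mem_eigenvaluesC (h : IsCompactificationData α β c a)
    (hW : IsOpen W) (hf : IsAsymptoticallyQuasiHomogeneous α k W f fα)
    (hx : IsEquilibriumAtInfinity α β c a W k f fα x)
    (hg : DifferentiableWithinAt ℝ (desingularized α β c a k f fα) (closedDisc α β c a W) x) :
    ((-2 * radialRate α β c a k f fα x : ℝ) : ℂ) ∈ eigenvaluesC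
      (jacobianWithin (desingularized α β c a k f fα) (closedDisc α β c a W) x) :=
  ofReal_mem_eigenvaluesC_of_comp_eq_smul
    (fun hzero => h.fderiv_horizonPoly_ne_zero hx.1 (ContinuousLinearMap.coe_injective hzero))
    (congrArg ContinuousLinearMap.toLinearMap (h.fderiv_horizonPoly_comp_fderivWithin hW hf hx hg))

theorem radialRate_ne_zero (h : IsCompactificationData α β c a) (hW : IsOpen W)
    (hf : IsAsymptoticallyQuasiHomogeneous α k W f fα)
    (hx : IsEquilibriumAtInfinity α β c a W k f fα x) {O : Set (Fin n → ℝ)} (hO : O ∈ 𝓝 x)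
    (hg : DifferentiableWithinAt ℝ (desingularized α β c a k f fα) (O ∩ closedDisc α β c a W) x)
    (hhyp : IsHyperbolicMatrix
      (jacobianWithin (desingularized α β c a k f fα) (O ∩ closedDisc α β c a W) x)) :
    radialRate α β c a k f fα x ≠ 0 := fun hzero => by
  rw [jacobianWithin_inter hO] at hhyp
  rw [inter_comm, differentiableWithinAt_inter hO] at hg
  exact hhyp _ (h.neg_two_mul_radialRate_mem_eigenvaluesC hW hf hx hg) (by simp [hzero])

end IsCompactificationData

end Equilibrium

section StableSet

variable {n : ℕ} {α β : Fin n → ℕ} {c : ℕ} {a : Fin n → ℝ} {k : ℕ}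
  {W : Set ({i : Fin n // α i = 0} → ℝ)} {f fα : (Fin n → ℝ) → (Fin n → ℝ)} {xs x₀ : Fin n → ℝ}

namespace IsCompactificationData

theorem mem_stableSet_disc (h : IsCompactificationData α β c a) (hW : IsOpen W)
    (hf : IsAsymptoticallyQuasiHomogeneous α k W f fα) (hx₀ : x₀ ∈ disc α β c a W)
    (hx : x₀ ∈ stableSet (desingularized α β c a k f fα) (closedDisc α β c a W) xs) :
    x₀ ∈ stableSet (desingularized α β c a k f fα) (disc α β c a W) xs := by
  obtain ⟨x, rfl, hsol, hlim⟩ := hx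
  refine ⟨x, rfl, fun τ hτ => ⟨?_, (hsol τ hτ).2⟩, hlim⟩
  have hderiv : ∀ σ ∈ Icc 0 τ,
      HasDerivWithinAt x (desingularized α β c a k f fα (x σ)) (Icc 0 τ) σ :=
    fun σ hσ => (hsol σ hσ.1).2.mono Icc_subset_Ici_self
  have hrate : ContinuousOn (fun σ => -2 * radialRate α β c a k f fα (x σ)) (Icc 0 τ) :=
    ((h.continuousOn_radialRate hW hf).comp (fun σ hσ => (hderiv σ hσ).continuousWithinAt)
      fun σ hσ => (hsol σ hσ.1).1).const_mul _
  have hne : 1 - horizonPoly α β a (x τ) ≠ 0 := ne_zero_of_hasDerivWithinAt_smul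
    (w := fun σ => 1 - horizonPoly α β a (x σ)) hτ hrate
    (fun σ hσ => h.hasDerivWithinAt_one_sub_horizonPoly (hderiv σ hσ))
    (sub_pos.2 (h.p_lt_one_iff.1 hx₀.2)).ne'
  exact (hsol τ hτ).1.resolve_right fun hhor =>
    hne (sub_eq_zero.2 (h.p_eq_one_iff.1 hhor.2).symm)

theorem tendsto_radialRate (h : IsCompactificationData α β c a) (hW : IsOpen W)
    (hf : IsAsymptoticallyQuasiHomogeneous α k W f fα) (hxs : xs ∈ horizon α β c a W)
    {ι : Type*} {l : Filter ι} {x : ι → Fin n → ℝ} (hx : ∀ᶠ t in l, x t ∈ disc α β c a W)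
    (hlim : Tendsto x l (𝓝 xs)) :
    Tendsto (fun t => radialRate α β c a k f fα (x t)) l
      (𝓝 (radialRate α β c a k f fα xs)) :=
  (h.continuousOn_radialRate hW hf xs (Or.inr hxs)).tendsto.comp
    (tendsto_nhdsWithin_iff.2 ⟨hlim, hx.mono fun _ => Or.inl⟩)

theorem radialRate_nonneg (h : IsCompactificationData α β c a) (hW : IsOpen W)
    (hf : IsAsymptoticallyQuasiHomogeneous α k W f fα) (hxs : xs ∈ horizon α β c a W)
    (hx : x₀ ∈ stableSet (desingularized α β c a k f fα) (disc α β c a W) xs) :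
    0 ≤ radialRate α β c a k f fα xs := by
  obtain ⟨x, -, hsol, hlim⟩ := hx
  have hpoly : Tendsto (fun τ => 1 - horizonPoly α β a (x τ)) atTop (𝓝 0) := by
    have := ((continuous_horizonPoly (α := α) (β := β) (a := a)).tendsto xs).comp hlim
    simpa [h.p_eq_one_iff.1 hxs.2] using this.const_sub 1
  have hrate := h.tendsto_radialRate hW hf hxs
    ((eventually_ge_atTop 0).mono fun τ hτ => (hsol τ hτ).1) hlim
  have := nonpos_of_tendsto_zero_of_hasDerivWithinAt_mul
    (fun τ hτ => sub_pos.2 (h.p_lt_one_iff.1 (hsol τ hτ).1.2))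
    (fun τ hτ => h.hasDerivWithinAt_one_sub_horizonPoly (hsol τ hτ).2) hpoly (hrate.const_mul (-2))
  linarith

end IsCompactificationData

end StableSet

section TimeChange

variable {n : ℕ}

/-- The desingularized time `τ` along `y`, given by `dτ = κ(y(t)) ^ k dt` and `τ = 0` at `t₀`. -/
noncomputable def rescaledTime (α β : Fin n → ℕ) (c : ℕ) (a : Fin n → ℝ) (k : ℕ)
    (y : ℝ → Fin n → ℝ) (t₀ t : ℝ) : ℝ :=
  ∫ r in t₀..t, kappa α β c a (y r) ^ k

variable {α β : Fin n → ℕ} {c : ℕ} {a : Fin n → ℝ} {k : ℕ}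
  {W : Set ({i : Fin n // α i = 0} → ℝ)} {f fα : (Fin n → ℝ) → (Fin n → ℝ)} {xs : Fin n → ℝ}
  {y : ℝ → Fin n → ℝ} {t₀ : ℝ}

theorem IsSolutionOn.continuousOn {U : Set (Fin n → ℝ)} {T : EReal}
    (hy : IsSolutionOn f U y t₀ T) {t₁ : ℝ} (ht₁ : (t₁ : EReal) < T) :
    ContinuousOn y (Icc t₀ t₁) := fun t ht =>
  (hy t ht.1 ((EReal.coe_le_coe_iff.2 ht.2).trans_lt ht₁)).2.continuousWithinAt.mono
    Icc_subset_Ici_self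

namespace IsCompactificationData

theorem continuousOn_kappa_pow_comp (h : IsCompactificationData α β c a) {s : Set ℝ}
    (hy : ContinuousOn y s) : ContinuousOn (fun t => kappa α β c a (y t) ^ k) s :=
  (h.continuous_kappa.comp_continuousOn hy).pow k

theorem sub_le_rescaledTime_sub (h : IsCompactificationData α β c a) {t₁ t₂ : ℝ}
    (h₀₁ : t₀ ≤ t₁) (h₁₂ : t₁ ≤ t₂) (hy : ContinuousOn y (Icc t₀ t₂)) :
    t₂ - t₁ ≤ rescaledTime α β c a k y t₀ t₂ - rescaledTime α β c a k y t₀ t₁ := by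
  have hint : ∀ {r s}, t₀ ≤ r → r ≤ s → s ≤ t₂ →
      IntervalIntegrable (fun t => kappa α β c a (y t) ^ k) MeasureTheory.volume r s :=
    fun h₀r hrs hs₂ => ((h.continuousOn_kappa_pow_comp hy).mono
      (Icc_subset_Icc h₀r hs₂)).intervalIntegrable_of_Icc hrs
  have hmono := intervalIntegral.integral_mono_on (f := fun _ => (1 : ℝ)) h₁₂
    intervalIntegrable_const (hint h₀₁ h₁₂ le_rfl)
    fun t _ => one_le_pow₀ (h.one_le_kappa (y t)) (n := k)
  rw [intervalIntegral.integral_const, smul_eq_mul, mul_one] at hmono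
  rwa [rescaledTime, rescaledTime, intervalIntegral.integral_interval_sub_left
    (hint le_rfl (h₀₁.trans h₁₂) le_rfl) (hint le_rfl h₀₁ h₁₂)]

theorem compactification_eq_comp_rescaledTime (h : IsCompactificationData α β c a)
    (hW : IsOpen W) (hf : ContDiffOn ℝ ∞ f (admissibleDomain α W)) {T : EReal}
    (hy : IsSolutionOn f (admissibleDomain α W) y t₀ T) {x : ℝ → Fin n → ℝ}
    (hx : ∀ τ, 0 ≤ τ → x τ ∈ disc α β c a W ∧
      HasDerivWithinAt x (desingularized α β c a k f fα (x τ)) (Ici 0) τ)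
    (hx₀ : x 0 = compactification α β c a (y t₀)) {t : ℝ} (ht₀ : t₀ ≤ t) (ht : (t : EReal) < T) :
    compactification α β c a (y t) = x (rescaledTime α β c a k y t₀ t) := by
  refine eq_comp_integral_of_hasDerivWithinAt_smul (h.isOpen_disc hW)
    ((h.contDiffOn_desingularized hf).of_le (by simp)) ht₀
    (h.continuousOn_kappa_pow_comp (hy.continuousOn ht)) (fun r _ => (pow_pos (h.kappa_pos _) k).le)
    (u := fun t => compactification α β c a (y t)) (fun r hr => ?_) hx hx₀.symm
  have hyr := hy r hr.1 ((EReal.coe_le_coe_iff.2 hr.2).trans_lt ht)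
  exact ⟨h.compactification_mem_disc hyr.1,
    h.hasDerivWithinAt_compactification (hyr.2.mono Icc_subset_Ici_self)⟩

theorem tendsto_rescaledTime_atTop (h : IsCompactificationData α β c a)
    {U : Set (Fin n → ℝ)} (hy : IsSolutionOn f U y t₀ ⊤) :
    Tendsto (rescaledTime α β c a k y t₀) atTop atTop := by
  refine tendsto_atTop_mono' atTop ?_ (tendsto_id.atTop_add (tendsto_const_nhds (x := -t₀)))
  filter_upwards [eventually_ge_atTop t₀] with t ht
  simpa [rescaledTime, sub_eq_add_neg] using
    h.sub_le_rescaledTime_sub (k := k) le_rfl ht (hy.continuousOn (EReal.coe_lt_top t))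

/-- If `τ` stayed bounded, `y` would converge in `U` and could be continued. -/
theorem tendsto_rescaledTime_nhdsLT (h : IsCompactificationData α β c a) (hW : IsOpen W)
    (hf : ContDiffOn ℝ ∞ f (admissibleDomain α W)) {T : ℝ}
    (hy : IsMaximalSolution f (admissibleDomain α W) y t₀ T) {x : ℝ → Fin n → ℝ}
    (hx : ∀ τ, 0 ≤ τ → x τ ∈ disc α β c a W ∧
      HasDerivWithinAt x (desingularized α β c a k f fα (x τ)) (Ici 0) τ)
    (hx₀ : x 0 = compactification α β c a (y t₀)) :
    Tendsto (rescaledTime α β c a k y t₀) (𝓝[<] T) atTop := by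
  have hT : t₀ < T := EReal.coe_lt_coe_iff.1 hy.lt
  have hgrow : ∀ {t₁ t₂}, t₀ ≤ t₁ → t₁ ≤ t₂ → t₂ < T →
      t₂ - t₁ ≤ rescaledTime α β c a k y t₀ t₂ - rescaledTime α β c a k y t₀ t₁ :=
    fun h₀₁ h₁₂ h₂T => h.sub_le_rescaledTime_sub h₀₁ h₁₂
      (hy.solution.continuousOn (EReal.coe_lt_coe_iff.2 h₂T))
  have hmono : MonotoneOn (rescaledTime α β c a k y t₀) (Ioo t₀ T) := fun t₁ h₁ t₂ h₂ h₁₂ => by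
    linarith [hgrow h₁.1.le h₁₂ h₂.2]
  refine (tendsto_nhdsLT_atTop_or_nhds_of_monotoneOn hT hmono).resolve_right ?_
  rintro ⟨S, hS⟩
  have hnonneg : ∀ᶠ t in 𝓝[<] T, 0 ≤ rescaledTime α β c a k y t₀ t := by
    filter_upwards [Ioo_mem_nhdsLT hT] with t ht
    have := hgrow le_rfl ht.1.le ht.2
    simp only [rescaledTime, intervalIntegral.integral_same, sub_zero] at this ⊢
    linarith [ht.1]
  have hxS := hx S (ge_of_tendsto hS hnonneg)
  have hX : Tendsto (fun t => x (rescaledTime α β c a k y t₀ t)) (𝓝[<] T) (𝓝 (x S)) :=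
    hxS.2.continuousWithinAt.tendsto.comp (tendsto_nhdsWithin_iff.2 ⟨hS, hnonneg⟩)
  have hinv : ContinuousAt (compactificationInv α β c a) (x S) :=
    contDiffOn_compactificationInv.continuousOn.continuousAt
      ((isOpen_lt continuous_horizonPoly continuous_const).mem_nhds (h.p_lt_one_iff.1 hxS.1.2))
  refine hy.not_tendsto (isOpen_admissibleDomain hW) (hf.of_le (by simp))
    (scale_mem_admissibleDomain_iff.2 (h.disc_eq W ▸ hxS.1).1) ((hinv.tendsto.comp hX).congr' ?_)
  filter_upwards [Ioo_mem_nhdsLT hT] with t ht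
  rw [Function.comp_apply, ← h.compactification_eq_comp_rescaledTime hW hf hy.solution hx hx₀
    ht.1.le (EReal.coe_lt_coe_iff.2 ht.2), h.compactificationInv_compactification]

end IsCompactificationData

end TimeChange

section BlowUp

variable {n : ℕ} {α β : Fin n → ℕ} {c : ℕ} {a : Fin n → ℝ} {k : ℕ}
  {W : Set ({i : Fin n // α i = 0} → ℝ)} {f fα : (Fin n → ℝ) → (Fin n → ℝ)} {xs : Fin n → ℝ}
  {y : ℝ → Fin n → ℝ} {t₀ T : ℝ}

namespace IsCompactificationData

theorem tendsto_compactification_atTop (h : IsCompactificationData α β c a) (hW : IsOpen W)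
    (hf : ContDiffOn ℝ ∞ f (admissibleDomain α W))
    (hy : IsSolutionOn f (admissibleDomain α W) y t₀ ⊤)
    (hys : compactification α β c a (y t₀) ∈
      stableSet (desingularized α β c a k f fα) (disc α β c a W) xs) :
    Tendsto (fun t => compactification α β c a (y t)) atTop (𝓝 xs) := by
  obtain ⟨x, hx₀, hx, hlim⟩ := hys
  refine (hlim.comp (h.tendsto_rescaledTime_atTop (k := k) hy)).congr' ?_
  filter_upwards [eventually_ge_atTop t₀] with t ht
  exact (h.compactification_eq_comp_rescaledTime hW hf hy hx hx₀ ht (EReal.coe_lt_top t)).symm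

theorem tendsto_compactification_nhdsLT (h : IsCompactificationData α β c a) (hW : IsOpen W)
    (hf : ContDiffOn ℝ ∞ f (admissibleDomain α W))
    (hy : IsMaximalSolution f (admissibleDomain α W) y t₀ T)
    (hys : compactification α β c a (y t₀) ∈
      stableSet (desingularized α β c a k f fα) (disc α β c a W) xs) :
    Tendsto (fun t => compactification α β c a (y t)) (𝓝[<] T) (𝓝 xs) := by
  obtain ⟨x, hx₀, hx, hlim⟩ := hys
  refine (hlim.comp (h.tendsto_rescaledTime_nhdsLT hW hf hy hx hx₀)).congr' ?_
  filter_upwards [Ioo_mem_nhdsLT (EReal.coe_lt_coe_iff.1 hy.lt)] with t ht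
  exact (h.compactification_eq_comp_rescaledTime hW hf hy.solution hx hx₀ ht.1.le
    (EReal.coe_lt_coe_iff.2 ht.2)).symm

theorem maximalTime_ne_top (h : IsCompactificationData α β c a) (hk : 0 < k) (hW : IsOpen W)
    (hf : IsAsymptoticallyQuasiHomogeneous α k W f fα) (hxs : xs ∈ horizon α β c a W)
    (hrate : 0 < radialRate α β c a k f fα xs) {tmax : EReal}
    (hy : IsSolutionOn f (admissibleDomain α W) y t₀ tmax)
    (hys : compactification α β c a (y t₀) ∈
      stableSet (desingularized α β c a k f fα) (disc α β c a W) xs) : tmax ≠ ⊤ := by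
  rintro rfl
  have hX := h.tendsto_compactification_atTop hW hf.smooth hy hys
  have hsol := fun t ht => hy t ht (EReal.coe_lt_top t)
  have hlim := h.tendsto_radialRate hW hf hxs ((eventually_ge_atTop t₀).mono
    fun t ht => h.compactification_mem_disc (hsol t ht).1) hX
  have hneg := nonneg_of_tendsto_deriv_of_pos
    (fun t _ => inv_pos.2 (pow_pos (h.kappa_pos (y t)) k))
    (fun t ht => h.hasDerivWithinAt_inv_kappa_pow (fα := fα) (hsol t ht).2)
    (hlim.const_mul (k / c : ℝ)).neg
  have := h.c_pos
  have : 0 < k / c * radialRate α β c a k f fα xs := by positivity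
  linarith

theorem isEquivalent_inv_kappa_pow (h : IsCompactificationData α β c a) (hk : k ≠ 0)
    (hW : IsOpen W) (hf : IsAsymptoticallyQuasiHomogeneous α k W f fα)
    (hxs : xs ∈ horizon α β c a W) (hrate : radialRate α β c a k f fα xs ≠ 0) (hT : t₀ < T)
    (hy : IsSolutionOn f (admissibleDomain α W) y t₀ T)
    (hX : Tendsto (fun t => compactification α β c a (y t)) (𝓝[<] T) (𝓝 xs)) :
    (fun t => (kappa α β c a (y t) ^ k)⁻¹) ~[𝓝[<] T]
      fun t => k / c * radialRate α β c a k f fα xs * (T - t) := by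
  have hsol : ∀ᶠ t in 𝓝[<] T, y t ∈ admissibleDomain α W ∧ HasDerivAt y (f (y t)) t :=
    (eventually_mem_set.2 (Ioo_mem_nhdsLT hT)).mono fun t ht =>
      hy.mem_and_hasDerivAt ht.1 (EReal.coe_lt_coe_iff.2 ht.2)
  have hdisc : ∀ᶠ t in 𝓝[<] T, compactification α β c a (y t) ∈ disc α β c a W :=
    hsol.mono fun t ht => h.compactification_mem_disc ht.1
  have hκ : Tendsto (fun t => kappa α β c a (y t)) (𝓝[<] T) atTop :=
    ((h.tendsto_kappaX_atTop hxs).comp (tendsto_nhdsWithin_iff.2 ⟨hX, hdisc⟩)).congr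
      fun t => h.kappaX_compactification (y t)
  have hc := h.c_pos.ne'
  refine isEquivalent_const_mul_sub_of_tendsto_deriv (by positivity)
    (hsol.mono fun t ht => ?_) (tendsto_inv_atTop_zero.comp ((tendsto_pow_atTop hk).comp hκ))
    ((h.tendsto_radialRate hW hf hxs hdisc hX).const_mul (k / c : ℝ)).neg
  exact hasDerivWithinAt_univ.1
    (h.hasDerivWithinAt_inv_kappa_pow (fα := fα) ht.2.hasDerivWithinAt)

theorem isEquivalent_kappa (h : IsCompactificationData α β c a) (hk : k ≠ 0) {A : ℝ} (hA : 0 ≤ A)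
    (hκ : (fun t => (kappa α β c a (y t) ^ k)⁻¹) ~[𝓝[<] T] fun t => A * (T - t)) :
    (fun t => kappa α β c a (y t)) ~[𝓝[<] T]
      fun t => A ^ (-(1 / (k : ℝ))) * (T - t) ^ (-(1 / (k : ℝ))) := by
  have habs : (fun t => (kappa α β c a (y t) ^ k)⁻¹) ~[𝓝[<] T] fun t => A * |T - t| :=
    hκ.congr_right <| eventually_nhdsWithin_of_forall fun t ht => by
      simp only [abs_of_pos (sub_pos.2 (mem_Iio.1 ht))]
  refine ((habs.rpow (r := -(1 / (k : ℝ))) fun t => by positivity).congr_left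
    (Eventually.of_forall fun t => ?_)).congr_right (eventually_nhdsWithin_of_forall fun t ht => ?_)
  · have hpos := (h.kappa_pos (y t)).le
    simp only [Pi.pow_apply]
    rw [Real.rpow_neg (by positivity), Real.inv_rpow (by positivity), inv_inv, one_div,
      Real.pow_rpow_inv_natCast hpos hk]
  · simp only [Pi.pow_apply]
    rw [Real.mul_rpow hA (abs_nonneg _), abs_of_pos (sub_pos.2 ht)]

theorem isEquivalent_p (h : IsCompactificationData α β c a) (hxs : xs ∈ horizon α β c a W)
    {ι : Type*} {l : Filter ι} {y : ι → Fin n → ℝ} {φ : ι → ℝ}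
    (hX : Tendsto (fun t => compactification α β c a (y t)) l (𝓝 xs))
    (hκ : (fun t => kappa α β c a (y t)) ~[l] φ) : (fun t => p α β c a (y t)) ~[l] φ := by
  have hp : ContinuousAt (p α β c a) xs := continuous_horizonPoly.continuousAt.rpow_const
    (Or.inl (by rw [h.p_eq_one_iff.1 hxs.2]; exact one_ne_zero))
  have hpX : (fun t => p α β c a (compactification α β c a (y t))) ~[l] fun _ => (1 : ℝ) :=
    (isEquivalent_const_iff_tendsto one_ne_zero).2 (hxs.2 ▸ hp.tendsto.comp hX)
  refine ((hκ.mul hpX).congr_left (Eventually.of_forall fun t => ?_)).congr_right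
    (Eventually.of_forall fun t => mul_one _)
  rw [Pi.mul_apply, ← h.p_scale (h.kappa_pos _).le, h.scale_kappa_compactification]

theorem isEquivalent_coord (h : IsCompactificationData α β c a) {i : Fin n} (hi : xs i ≠ 0)
    {ι : Type*} {l : Filter ι} {y : ι → Fin n → ℝ} {φ : ι → ℝ}
    (hX : Tendsto (fun t => compactification α β c a (y t)) l (𝓝 xs))
    (hκ : (fun t => kappa α β c a (y t)) ~[l] φ) :
    (fun t => y t i) ~[l] fun t => φ t ^ α i * xs i := by
  have hXi : (fun t => compactification α β c a (y t) i) ~[l] fun _ => xs i :=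
    (isEquivalent_const_iff_tendsto hi).2 (((continuous_apply i).tendsto xs).comp hX)
  exact ((hκ.pow (α i)).mul hXi).congr_left <| Eventually.of_forall fun t =>
    congrFun (h.scale_kappa_compactification (y t)) i

end IsCompactificationData

end BlowUp

end QuasiPoincare

open QuasiPoincare

theorem mainTheorem1_general {n : ℕ} {α β : Fin n → ℕ} {c : ℕ} {a : Fin n → ℝ}
    (hdata : IsCompactificationData α β c a) {k : ℕ} (hk : 1 ≤ k)
    {W : Set ({i : Fin n // α i = 0} → ℝ)} (hW : IsOpen W) {f fα : (Fin n → ℝ) → (Fin n → ℝ)}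
    (hf : IsAsymptoticallyQuasiHomogeneous α k W f fα) {xs : Fin n → ℝ}
    (hxs : xs ∈ horizon α β c a W) (hrate : radialRate α β c a k f fα xs ≠ 0)
    {y : ℝ → (Fin n → ℝ)} {t₀ : ℝ} {tmax : EReal}
    (hy : IsMaximalSolution f (admissibleDomain α W) y t₀ tmax)
    (hys : compactification α β c a (y t₀) ∈
      stableSet (desingularized α β c a k f fα) (closedDisc α β c a W) xs) :
    ∃ T : ℝ, tmax = T ∧
      (∃ C : ℝ, 0 < C ∧
        (fun t => p α β c a (y t)) ~[𝓝[<] T] fun t => C * (T - t) ^ (-(1 / (k : ℝ)))) ∧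
      ∀ i, xs i ≠ 0 → ∃ C : ℝ, C ≠ 0 ∧
        (fun t => y t i) ~[𝓝[<] T] fun t => C * (T - t) ^ (-((α i : ℝ) / k)) := by
  have hys' := hdata.mem_stableSet_disc hW hf
    (hdata.compactification_mem_disc (hy.solution t₀ le_rfl hy.lt).1) hys
  have hpos := (hdata.radialRate_nonneg hW hf hxs hys').lt_of_ne' hrate
  lift tmax to ℝ using
    ⟨hdata.maximalTime_ne_top hk hW hf hxs hpos hy.solution hys', hy.lt.ne_bot⟩ with T
  have hX := hdata.tendsto_compactification_nhdsLT hW hf.smooth hy hys'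
  have hc := hdata.c_pos
  set A := k / c * radialRate α β c a k f fα xs
  have hA : 0 < A := by positivity
  have hκ := hdata.isEquivalent_kappa (by omega) hA.le <|
    hdata.isEquivalent_inv_kappa_pow (by omega) hW hf hxs hrate
      (EReal.coe_lt_coe_iff.1 hy.lt) hy.solution hX
  refine ⟨T, rfl, ⟨_, Real.rpow_pos_of_pos hA _, hdata.isEquivalent_p hxs hX hκ⟩, fun i hi =>
    ⟨(A ^ (-(1 / (k : ℝ)))) ^ α i * xs i, by positivity,
      (hdata.isEquivalent_coord hi hX hκ).congr_right ?_⟩⟩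
  filter_upwards [self_mem_nhdsWithin] with t ht
  rw [mul_pow, ← Real.rpow_mul_natCast (sub_pos.2 ht).le, mul_right_comm,
    neg_mul, one_div_mul_eq_div]

theorem mainTheorem1 {n : ℕ} (α β : Fin n → ℕ) (c : ℕ) (a : Fin n → ℝ)
    (hdata : QuasiPoincare.IsCompactificationData α β c a)
    (k : ℕ) (hk : 1 ≤ k)
    (W : Set ({i : Fin n // α i = 0} → ℝ)) (hW : IsOpen W)
    (f fα : (Fin n → ℝ) → (Fin n → ℝ))
    (hf : QuasiPoincare.IsAsymptoticallyQuasiHomogeneous α k W f fα)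
    (xs : Fin n → ℝ)
    (hxs : QuasiPoincare.IsEquilibriumAtInfinity α β c a W k f fα xs)
    (V : Set (Fin n → ℝ))
    (hVopen : ∃ O : Set (Fin n → ℝ), IsOpen O ∧
      V = O ∩ QuasiPoincare.closedDisc α β c a W)
    (hVhorizon : QuasiPoincare.horizon α β c a W ⊆ V)
    (hg : ContDiffOn ℝ 1 (QuasiPoincare.desingularized α β c a k f fα) V)
    (hhyp : QuasiPoincare.IsHyperbolicMatrix
      (QuasiPoincare.jacobianWithin (QuasiPoincare.desingularized α β c a k f fα) V xs))
    (hns : 0 < QuasiPoincare.stableCount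
      (QuasiPoincare.jacobianWithin (QuasiPoincare.desingularized α β c a k f fα) V xs))
    (y : ℝ → (Fin n → ℝ)) (t₀ : ℝ) (tmax : EReal)
    (hy : QuasiPoincare.IsMaximalSolution f (QuasiPoincare.admissibleDomain α W) y t₀ tmax)
    (hys : QuasiPoincare.compactification α β c a (y t₀) ∈
      QuasiPoincare.stableSet (QuasiPoincare.desingularized α β c a k f fα)
        (QuasiPoincare.closedDisc α β c a W) xs) :
    ∃ T : ℝ, tmax = (T : EReal) ∧
      (∃ C : ℝ, 0 < C ∧
        (fun t => QuasiPoincare.p α β c a (y t)) ~[𝓝[<] T]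
          (fun t => C * (T - t) ^ (-(1 / (k : ℝ))))) ∧
      (∀ i ∈ QuasiPoincare.homIndices α, xs i ≠ 0 →
        ∃ C : ℝ, C ≠ 0 ∧
          (fun t => y t i) ~[𝓝[<] T]
            (fun t => C * (T - t) ^ (-((α i : ℝ) / (k : ℝ))))) := by
  obtain ⟨O, hO, rfl⟩ := hVopen
  have hrate := hdata.radialRate_ne_zero hW hf hxs (hO.mem_nhds (hVhorizon hxs.1).1)
    (hg.differentiableOn one_ne_zero xs (hVhorizon hxs.1)) hhyp
  exact (mainTheorem1_general hdata hk hW hf hxs.1 hrate hy hys).imp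
    fun _ ⟨hT, hp, hcoord⟩ => ⟨hT, hp, fun i _ => hcoord i⟩
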